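/- Let $H$ be a complex Hilbert space, let $\nu(T)=\sup\{|\langle Tx,x\rangle| : \|x\|=1\}$ denote the numerical radius of $T\in\mathcal L(H)$, and for $1\le p<\infty$ let $S_p(H)$ be the class of compact operators $T$ on $H$ with $$\sigma_p(T)=\Big(\sum_j\lambda_j^p\Big)^{1/p}<\infty,$$ where $(\lambda_j)$ are the non-zero eigenvalues of $|T|=(T^*T)^{1/2}$ counted with multiplicity. A Schatten–von Neumann operator is an element of $S_p(H)$ for some $1\le p<\infty$. For a class $\mathcal A\subset\mathcal L(H)$, $H$ has the BPBpp-$\nu$ (Bishop–Phelps–Bollobás point property for numerical radius) for $\mathcal A$ if for every $\varepsilon>0$ there is $\eta>0$ such that, whenever $T\in\mathcal A$ with $\nu(T)=1$ and $x_0\in H$ with $\|x_0\|=1$ satisfy $|\langle Tx_0,x_0\rangle|>1-\eta$, there is $S\in\mathcal A$ with $$\nu(S)=|\langle Sx_0,x_0\rangle|=1\quad\text{and}\quad\|S-T\|<\varepsilon .$$ Then: 1. $H$ has the BPBpp-$\nu$ for the class of normal operators in $S_p(H)$, for every $1\le p<\infty$, and also for the class of all normal Schatten–von Neumann operators. 2.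 Let $1\le p<\infty$ and $0<\varepsilon<\tfrac12$, let $T\in S_p(H)$ be normal with $\nu(T)=1$ and $\sigma_p(T)\le M$, and let $\|x_0\|=1$ with $|\langle Tx_0,x_0\rangle|>1-\varepsilon$. Let $E$ be the spectral measure of $T$, let $\Delta=\{z\in\sigma(T):|z|>1-\sqrt{2\varepsilon}\}$, and put $$N_1=\int_{\Delta}\frac{z}{|z|}\,dE(z),\qquad N_2=\int_{\sigma(T)\setminus\Delta}z\,dE(z).$$ Then there are a unitary operator $R$ on $H$ that is the identity on $\ker E(\Delta)$ and a unit vector $x_1\in H$ such that $S=R^*N_1+N_2$ is a normal operator in $S_p(H)$ with $\nu(S)=|\langle Sx_1,x_1\rangle|=1$, $$\|x_1-x_0\|\le\sqrt{2\varepsilon}+\sqrt[4]{2\varepsilon},\qquad \|S-T\|\le\frac{\sqrt{2\varepsilon}+2\sqrt[4]{2\varepsilon}}{1-\sqrt{2\varepsilon}}+2\sqrt{2\varepsilon},$$ and $$\sigma_p(S-T)\le\left(\frac{\sqrt{2\varepsilon}+2\sqrt[4]{2\varepsilon}}{1-\sqrt{2\varepsilon}}+\sqrt{2\varepsilon}\right)\frac{M}{1-\sqrt{2\varepsilon}}+\frac{M\sqrt{2\varepsilon}}{1-\sqrt{2\varepsilon}}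 .$$ -/

import Mathlib

open scoped ENNReal InnerProductSpace

noncomputable section

namespace BPBNu

variable {H : Type*} [NormedAddCommGroup H] [InnerProductSpace ℂ H]

/-- The numerical radius `ν(T) = sup {|⟨T x, x⟩| : ‖x‖ = 1}`. The set is bounded by `‖T‖`, so the
supremum is a genuine one as soon as `H ≠ 0`. -/
def numericalRadius (T : H →L[ℂ] H) : ℝ :=
  sSup {r : ℝ | ∃ x : H, ‖x‖ = 1 ∧ r = ‖⟪x, T x⟫_ℂ‖}

/-- The Bishop-Phelps-Bollobás point property for numerical radius for a class `A` of bounded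
operators on `H`. -/
def HasBPBppNu (A : Set (H →L[ℂ] H)) : Prop :=
  ∀ ε : ℝ, 0 < ε → ∃ η : ℝ, 0 < η ∧
    ∀ T ∈ A, numericalRadius T = 1 → ∀ x₀ : H, ‖x₀‖ = 1 → ‖⟪x₀, T x₀⟫_ℂ‖ > 1 - η →
      ∃ S ∈ A, numericalRadius S = 1 ∧ ‖⟪x₀, S x₀⟫_ℂ‖ = 1 ∧ ‖S - T‖ < ε

variable [CompleteSpace H]

/-- `σ_p(T) = (∑ λ_j ^ p) ^ (1 / p)`, where `λ_j` runs over the positive eigenvalues of `|T|`, each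
counted according to its multiplicity, that is: every positive real `l` contributes
`dim ker (|T| - l)` copies of `l ^ p`. It is used only for compact `T`, where these dimensions are
finite. -/
def schattenNorm (p : ℝ) (T : H →L[ℂ] H) : ℝ≥0∞ :=
  (∑' l : Set.Ioi (0 : ℝ),
    (Module.finrank ℂ (Module.End.eigenspace (CFC.abs T : H →L[ℂ] H).toLinearMap ((l : ℝ) : ℂ)) :
      ℝ≥0∞) * ENNReal.ofReal ((l : ℝ) ^ p)) ^ (1 / p)

variable (H) in
/-- The Schatten-von Neumann class `S_p(H)`. -/
def schattenClass (p : ℝ) : Set (H →L[ℂ] H) :=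
  {T | IsCompactOperator T ∧ schattenNorm p T < ∞}

variable (H) in
/-- The normal operators in `S_p(H)`. -/
def normalSchattenClass (p : ℝ) : Set (H →L[ℂ] H) :=
  {T | IsStarNormal T ∧ T ∈ schattenClass H p}

/- The three spectral integrals below are written with the continuous functional calculus. They are
applied to compact normal `T` and `r > 0` only: the part of `σ(T)` outside the closed disk of
radius `r` is then finite and isolated from the rest of `σ(T)`, so that the three integrands are
continuous on `σ(T)` and the calculus gives the integral against the spectral measure of `T`. -/

/-- The spectral projection `E(σ(T) \ B(r))`, with `B(r)` the closed disk of radius `r`. -/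
def outerProj (r : ℝ) (T : H →L[ℂ] H) : H →L[ℂ] H :=
  cfc (fun z : ℂ => if r < ‖z‖ then (1 : ℂ) else 0) T

/-- `N₁ = ∫ z / |z| dE(z)` over `σ(T) \ B(r)`. -/
def outerPart (r : ℝ) (T : H →L[ℂ] H) : H →L[ℂ] H :=
  cfc (fun z : ℂ => if r < ‖z‖ then z / (‖z‖ : ℂ) else 0) T

/-- `N₂ = ∫ z dE(z)` over `σ(T) ∩ B(r)`. -/
def innerPart (r : ℝ) (T : H →L[ℂ] H) : H →L[ℂ] H :=
  cfc (fun z : ℂ => if ‖z‖ ≤ r then z else 0) T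

end BPBNu

end

noncomputable section

namespace BPBNu

/-! ### Numerical radius, plane rotations and eigenspaces of the absolute value. -/

section

variable {H : Type*} [NormedAddCommGroup H] [InnerProductSpace ℂ H]

/-! For compact normal `T` the numerical radius is the norm, so `‖T‖ = 1`. Put `s = √(2ε)`, so that
`ε = s² / 2`, and let `P` be the spectral projection for `|z| > 1 - s`, which has finite rank. Off
the range of `P` the operator has norm at most `1 - s`, so near-attainment at `x₀` forces `‖x₀ - P
x₀‖² < s / 2`. Let `x₁` be the normalization of `P x₀`. The operator `N₁` is unitary on the range of
`P` and within `s` of `T` there, so `|⟨N₁ x₁, x₁⟩|` is close to `1` (`outerProj_estimates`).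

After multiplication by a phase, `N₁ x₁` is a unit vector `w` at a small acute angle to `x₁`. Let
`R` be the plane rotation with `R x₁ = w` (`exists_unitary_rotation`); it fixes `ker P`, and `‖R -
1‖ ≤ ‖w - x₁‖`. Then `S = R* N₁ + N₂` has `x₁` as an eigenvector with unimodular eigenvalue. Since
`S* S = P + N₂* N₂` and `S S* = P + N₂ N₂*`, it is a normal contraction, and `|S|` differs from
`|T|` only on the range of `P`.

The Schatten bound needs no triangle inequality: `S - T` lives on the range of `P`, of dimension
`d`, so `σ_p(S - T) ≤ d^(1/p) ‖S - T‖`, while `d (1 - s)^p ≤ σ_p(T)^p`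
(`schattenNorm_le_of_mul_outerProj`). For the point property, conjugating `S` by a rotation `U` with
`U x₀ = x₁` moves the attaining vector back to `x₀`; no constant involves `p`, so one `η` serves all
the classes. -/

theorem norm_inner_le_norm_of_unit (T : H →L[ℂ] H) {x : H} (hx : ‖x‖ = 1) :
    ‖⟪x, T x⟫_ℂ‖ ≤ ‖T‖ := by
  calc ‖⟪x, T x⟫_ℂ‖ ≤ ‖x‖ * ‖T x‖ := norm_inner_le_norm _ _
    _ ≤ ‖x‖ * (‖T‖ * ‖x‖) := by gcongr; exact T.le_opNorm x
    _ = ‖T‖ := by rw [hx]; ring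

theorem norm_inner_le_numericalRadius (T : H →L[ℂ] H) {x : H} (hx : ‖x‖ = 1) :
    ‖⟪x, T x⟫_ℂ‖ ≤ numericalRadius T := by
  apply le_csSup
  · refine ⟨‖T‖, ?_⟩
    rintro _ ⟨y, hy, rfl⟩
    exact norm_inner_le_norm_of_unit T hy
  · exact ⟨x, hx, rfl⟩

theorem numericalRadius_eq_one {T : H →L[ℂ] H} (hT : ‖T‖ ≤ 1) {x : H} (hx : ‖x‖ = 1)
    (h : ‖⟪x, T x⟫_ℂ‖ = 1) : numericalRadius T = 1 := by
  apply le_antisymm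
  · refine csSup_le ⟨‖⟪x, T x⟫_ℂ‖, x, hx, rfl⟩ ?_
    rintro _ ⟨y, hy, rfl⟩
    exact (norm_inner_le_norm_of_unit T hy).trans hT
  · rw [← h]; exact norm_inner_le_numericalRadius T hx

variable [CompleteSpace H]

/-- A plane rotation carrying one unit vector to another one at an acute angle. -/
theorem exists_unitary_rotation {x w : H} (hx : ‖x‖ = 1) (hw : ‖w‖ = 1) {c : ℝ} (hc : 0 ≤ c)
    (hxw : ⟪x, w⟫_ℂ = c) :
    ∃ R ∈ unitary (H →L[ℂ] H), R x = w ∧ (∀ y, ⟪x, y⟫_ℂ = 0 → ⟪w, y⟫_ℂ = 0 → R y = y) ∧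
      ‖R - 1‖ ≤ ‖w - x‖ := by
  have hwx : ⟪w, x⟫_ℂ = c := by rw [← inner_conj_symm, hxw, Complex.conj_ofReal]
  have hxx : ⟪x, x⟫_ℂ = 1 := by rw [inner_self_eq_norm_sq_to_K, hx]; simp
  have hww : ⟪w, w⟫_ℂ = 1 := by rw [inner_self_eq_norm_sq_to_K, hw]; simp
  have hd : ‖w - x‖ ^ 2 = 2 - 2 * c := by
    rw [@norm_sub_sq ℂ, hwx, hw, hx]; simp; ring
  have hc1 : c ≤ 1 := by nlinarith [sq_nonneg ‖w - x‖]
  rcases eq_or_lt_of_le hc1 with rfl | hc1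
  · have : w = x := by
      rw [← sub_eq_zero, ← norm_eq_zero, ← sq_eq_zero_iff, hd]; norm_num
    subst this
    exact ⟨1, one_mem _, rfl, fun _ _ _ => rfl, by simp⟩
  -- With `c` the cosine and `q` the sine of the angle, `f` completes `x` to an orthonormal basis of
  -- the plane of `x` and `w`.
  set q : ℝ := √(1 - c ^ 2) with hq
  have hq2 : q ^ 2 = 1 - c ^ 2 := Real.sq_sqrt (by nlinarith)
  have hq0 : q ≠ 0 := by
    intro h; rw [h] at hq2; nlinarith
  have hqc : (q : ℂ) ≠ 0 := by exact_mod_cast hq0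
  have hq2c : (q : ℂ) ^ 2 = 1 - (c : ℂ) ^ 2 := by exact_mod_cast hq2
  set f : H := (q : ℂ)⁻¹ • (w - (c : ℂ) • x) with hf
  have hwf : w = (c : ℂ) • x + (q : ℂ) • f := by
    rw [hf, smul_smul, mul_inv_cancel₀ hqc]; simp
  have hxf : ⟪x, f⟫_ℂ = 0 := by
    rw [hf, inner_smul_right, inner_sub_right, inner_smul_right, hxw, hxx]; simp
  have hfx : ⟪f, x⟫_ℂ = 0 := by rw [← inner_conj_symm, hxf, map_zero]
  have hff : ⟪f, f⟫_ℂ = 1 := by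
    rw [hf, inner_smul_right, inner_smul_left, inner_sub_left, inner_sub_right, inner_sub_right,
      inner_smul_left, inner_smul_left, inner_smul_right, inner_smul_right, hxw, hwx, hxx, hww]
    simp only [map_inv₀, Complex.conj_ofReal]
    field_simp
    rw [hq2c]; ring
  have hfn : ‖f‖ = 1 := by
    have h : ‖f‖ ^ 2 = 1 := by rw [norm_sq_eq_re_inner (𝕜 := ℂ) f, hff]; simp
    nlinarith [norm_nonneg f]
  let rk : H → H → (H →L[ℂ] H) := fun a b => InnerProductSpace.rankOne ℂ a b
  have hmul : ∀ a b a' b', rk a b * rk a' b' = ⟪b, a'⟫_ℂ • rk a b' := fun a b a' b' => by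
    ext y; simp [rk, smul_smul, mul_comm]
  have hstar : ∀ a b, star (rk a b) = rk b a := fun a b => by
    simp [rk, ContinuousLinearMap.star_eq_adjoint]
  set Q : H →L[ℂ] H := rk x x + rk f f with hQ
  set J : H →L[ℂ] H := rk f x - rk x f with hJ
  have hQs : star Q = Q := by simp [hQ, hstar]
  have hJs : star J = -J := by simp [hJ, hstar]
  have hQQ : Q * Q = Q := by
    simp [hQ, add_mul, mul_add, hmul, hx, hfn, hxf, hfx]
  have hQJ : Q * J = J := by
    simp [hQ, hJ, add_mul, mul_sub, hmul, hx, hfn, hxf, hfx]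
  have hJQ : J * Q = J := by
    simp [hQ, hJ, sub_mul, mul_add, hmul, hx, hfn, hxf, hfx]; abel
  have hJJ : J * J = -Q := by
    simp [hQ, hJ, sub_mul, mul_sub, hmul, hx, hfn, hxf, hfx]; abel
  -- The rotation is `1 + D`, with `Q` the projection onto the plane and `J` its quarter turn. Both
  -- unitarity and the norm bound come from `D* D = (2 - 2c) Q`, where `2 - 2c = ‖w - x‖²`.
  set D : H →L[ℂ] H := ((c : ℂ) - 1) • Q + (q : ℂ) • J with hD
  have hDs : star D = ((c : ℂ) - 1) • Q - (q : ℂ) • J := by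
    simp [hD, hQs, hJs, sub_eq_add_neg]
  have hDD : star D * D = (2 - 2 * (c : ℂ)) • Q := by
    rw [hDs, hD]
    simp only [sub_mul, mul_add, smul_mul_assoc, mul_smul_comm, hQQ, hQJ, hJQ, hJJ]
    linear_combination (norm := module) hq2c • Q
  have hDD' : D * star D = (2 - 2 * (c : ℂ)) • Q := by
    rw [hDs, hD]
    simp only [mul_sub, add_mul, smul_mul_assoc, mul_smul_comm, hQQ, hQJ, hJQ, hJJ]
    linear_combination (norm := module) hq2c • Q
  have hsum : D + star D = -((2 - 2 * (c : ℂ)) • Q) := by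
    rw [hDs, hD]; module
  have hQn : ‖Q‖ ≤ 1 := by
    have h := CStarRing.norm_star_mul_self (x := Q)
    rw [hQs, hQQ] at h
    by_contra! hlt
    nlinarith
  refine ⟨1 + D, ?_, ?_, ?_, ?_⟩
  · rw [Unitary.mem_iff]
    constructor
    · have h : star (1 + D) * (1 + D) = 1 + (D + star D) + star D * D := by
        rw [star_add, star_one]; noncomm_ring
      rw [h, hsum, hDD, neg_add_cancel_right]
    · have h : (1 + D) * star (1 + D) = 1 + (D + star D) + D * star D := by
        rw [star_add, star_one]; noncomm_ring
      rw [h, hsum, hDD', neg_add_cancel_right]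
  · have h1 : Q x = x := by simp [hQ, rk, hx, hfx]
    have h2 : J x = f := by simp [hJ, rk, hx, hfx]
    simp only [hD, add_apply, one_apply_eq_self, smul_apply, h1, h2]
    rw [hwf]; module
  · intro y hxy hwy
    have hfy : ⟪f, y⟫_ℂ = 0 := by
      rw [hf, inner_smul_left, inner_sub_left, inner_smul_left, hxy, hwy]; simp
    simp [hD, hQ, hJ, rk, hxy, hfy]
  · rw [add_sub_cancel_left]
    have h := CStarRing.norm_star_mul_self (x := D)
    rw [hDD, norm_smul] at h
    have h2 : ‖(2 - 2 * (c : ℂ))‖ = 2 - 2 * c := by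
      rw [show (2 - 2 * (c : ℂ)) = ((2 - 2 * c : ℝ) : ℂ) by push_cast; ring, Complex.norm_real,
        Real.norm_of_nonneg (by linarith)]
    rw [h2] at h
    refine abs_le_of_sq_le_sq' ?_ (norm_nonneg _) |>.2
    rw [hd, sq, ← h]
    nlinarith

/-- The eigenspaces of `|A|` are eigenspaces of `A* A`. -/
theorem mem_eigenspace_abs_iff (A : H →L[ℂ] H) {l : ℝ} (hl : 0 < l) (y : H) :
    y ∈ Module.End.eigenspace (CFC.abs A : H →L[ℂ] H).toLinearMap (l : ℂ) ↔
      (star A * A) y = ((l ^ 2 : ℝ) : ℂ) • y := by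
  rw [Module.End.mem_eigenspace_iff, ← CFC.abs_mul_abs A]
  set B : H →L[ℂ] H := CFC.abs A with hB
  have hpos : B.IsPositive := by
    rw [← ContinuousLinearMap.nonneg_iff_isPositive]; exact CFC.abs_nonneg A
  constructor
  · intro h
    have h : B y = (l : ℂ) • y := h
    change B (B y) = _
    rw [h, map_smul, h, smul_smul]; push_cast; rw [sq]
  · intro h
    have h : B (B y) = ((l ^ 2 : ℝ) : ℂ) • y := h
    -- Factor `B² - l² = (B + l)(B - l)`: `z` satisfies `B z = -l z`, impossible for `B ≥ 0` and `l
    -- > 0` unless `z = 0`.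
    set z := B y - (l : ℂ) • y with hz
    have h1 : B z = -((l : ℂ) • z) := by
      rw [hz, map_sub, h, map_smul]; push_cast; module
    have h2 := hpos.re_inner_nonneg_left z
    rw [h1, inner_neg_left, inner_smul_left, inner_self_eq_norm_sq_to_K] at h2
    have h4 : 0 ≤ -(l * ‖z‖ ^ 2) := by
      have : (-((starRingEnd ℂ) (l : ℂ) * ((‖z‖ : ℝ) : ℂ) ^ 2)) = ((-(l * ‖z‖ ^ 2) : ℝ) : ℂ) := by
        rw [Complex.conj_ofReal]; push_cast; ring
      simpa [← Complex.ofReal_pow] using h2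
    have h5 : ‖z‖ ^ 2 ≤ 0 := by
      by_contra! h6
      nlinarith
    have h6 : z = 0 := by
      rw [← norm_eq_zero, ← sq_eq_zero_iff]; exact le_antisymm h5 (sq_nonneg _)
    exact sub_eq_zero.mp h6

end

/-! ### Schatten sums and multiplicities. -/

section

variable {H : Type*} [NormedAddCommGroup H] [InnerProductSpace ℂ H]

/-- The dimensions of finitely many independent subspaces of a finite-dimensional one add up to at
most its dimension. -/
theorem sum_finrank_le_of_iSupIndep {V : Type*} [AddCommGroup V] [Module ℂ V] {ι : Type*}
    (E : ι → Submodule ℂ V) (hE : iSupIndep E) (W : Submodule ℂ V) [FiniteDimensional ℂ W]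
    (hW : ∀ i, E i ≤ W) (s : Finset ι) :
    ∑ i ∈ s, Module.finrank ℂ (E i) ≤ Module.finrank ℂ W := by
  classical
  have hfin : ∀ i, FiniteDimensional ℂ (E i) := fun i =>
    Submodule.finiteDimensional_of_le (hW i)
  have hE' : iSupIndep fun i : s => E i := hE.comp Subtype.val_injective
  have hinj := hE'.dfinsupp_lsum_injective
  let f := DFinsupp.lsum ℕ (R := ℂ) fun i : s => (E i).subtype
  have hf : ∀ m, f m ∈ W := by
    intro m
    induction m using DFinsupp.induction with
    | h0 => simp [f]
    | ha i b m _ _ ih =>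
      rw [map_add]
      refine W.add_mem ?_ ih
      simpa [f] using hW i b.2
  have := LinearMap.finrank_le_finrank_of_injective (f := f.codRestrict W hf)
    (fun a b hab => hinj (congrArg Subtype.val hab))
  calc ∑ i ∈ s, Module.finrank ℂ (E i) = ∑ i : s, Module.finrank ℂ (E i) :=
        (Finset.sum_coe_sort s fun i => Module.finrank ℂ (E i)).symm
    _ = Module.finrank ℂ (DirectSum s fun i => E i) := (Module.finrank_directSum (R := ℂ) fun i : s => E i).symm
    _ ≤ _ := this

variable [CompleteSpace H]

/-- The eigenspace of `|A|` with eigenvalue `l`. -/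
abbrev absEigenspace (A : H →L[ℂ] H) (l : ℝ) : Submodule ℂ H :=
  Module.End.eigenspace (CFC.abs A : H →L[ℂ] H).toLinearMap (l : ℂ)

/-- The sum `∑ λ_j ^ p` over the positive eigenvalues of `|A|`. -/
def schattenSum (p : ℝ) (A : H →L[ℂ] H) : ℝ≥0∞ :=
  ∑' l : Set.Ioi (0 : ℝ), (Module.finrank ℂ (absEigenspace A l) : ℝ≥0∞) *
    ENNReal.ofReal ((l : ℝ) ^ p)

theorem schattenNorm_eq (p : ℝ) (A : H →L[ℂ] H) :
    schattenNorm p A = schattenSum p A ^ (1 / p) := rfl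

theorem schattenNorm_lt_top_iff {p : ℝ} (hp : 1 ≤ p) (A : H →L[ℂ] H) :
    schattenNorm p A < ∞ ↔ schattenSum p A < ∞ := by
  rw [schattenNorm_eq, ENNReal.rpow_lt_top_iff_of_pos (by positivity)]

theorem iSupIndep_absEigenspace (A : H →L[ℂ] H) :
    iSupIndep fun l : Set.Ioi (0 : ℝ) => absEigenspace A l :=
  (Module.End.eigenspaces_iSupIndep (CFC.abs A : H →L[ℂ] H).toLinearMap).comp
    (f := fun l : Set.Ioi (0 : ℝ) => ((l : ℝ) : ℂ))
    (fun _ _ h => Subtype.ext (Complex.ofReal_injective h))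

theorem le_norm_of_absEigenspace_ne_bot {A : H →L[ℂ] H} {l : ℝ} (hl : 0 < l)
    (h : absEigenspace A l ≠ ⊥) : l ≤ ‖A‖ := by
  obtain ⟨y, hy, hy0⟩ := Submodule.exists_mem_ne_zero_of_ne_bot h
  rw [mem_eigenspace_abs_iff A hl] at hy
  have h1 : ‖(star A * A) y‖ ≤ ‖A‖ * ‖A‖ * ‖y‖ := by
    rw [← CStarRing.norm_star_mul_self (x := A)]; exact (star A * A).le_opNorm y
  rw [hy, norm_smul, Complex.norm_real, Real.norm_of_nonneg (sq_nonneg l)] at h1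
  have h2 := le_of_mul_le_mul_right h1 (norm_pos_iff.mpr hy0)
  nlinarith [norm_nonneg A]

/-- An operator living on a subspace of dimension `d` satisfies `∑ λ_j ^ p ≤ d ‖A‖ ^ p`. -/
theorem schattenSum_le_of_mul_eq {p : ℝ} (hp : 1 ≤ p) {A P : H →L[ℂ] H} (hP : star P = P)
    (hAP : A * P = A) [FiniteDimensional ℂ (Module.End.eigenspace P.toLinearMap (1 : ℂ))] :
    schattenSum p A ≤
      Module.finrank ℂ (Module.End.eigenspace P.toLinearMap (1 : ℂ)) * ENNReal.ofReal (‖A‖ ^ p) := by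
  -- From `A P = A` follows `P A* A = A* A`, so eigenvectors of `A* A` with nonzero eigenvalue are
  -- fixed by `P`.
  have hle : ∀ l : Set.Ioi (0 : ℝ),
      absEigenspace A l ≤ Module.End.eigenspace P.toLinearMap (1 : ℂ) := by
    intro l y hy
    have hl : (0 : ℝ) < l := l.2
    rw [mem_eigenspace_abs_iff A hl] at hy
    have h1 : P * (star A * A) = star A * A := by
      rw [← mul_assoc]; nth_rewrite 1 [← hP]; rw [← star_mul, hAP]
    have h2 : P ((star A * A) y) = (star A * A) y := congrArg (fun B : H →L[ℂ] H => B y) h1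
    rw [hy, map_smul] at h2
    have hl0 : (((l : ℝ) ^ 2 : ℝ) : ℂ) ≠ 0 := by exact_mod_cast (pow_pos hl 2).ne'
    rw [Module.End.mem_eigenspace_iff, one_smul]
    exact smul_right_injective H hl0 h2
  rw [schattenSum, ENNReal.tsum_eq_iSup_sum]
  refine iSup_le fun s => ?_
  calc ∑ l ∈ s, (Module.finrank ℂ (absEigenspace A l) : ℝ≥0∞) * ENNReal.ofReal ((l : ℝ) ^ p)
      ≤ ∑ l ∈ s, (Module.finrank ℂ (absEigenspace A l) : ℝ≥0∞) * ENNReal.ofReal (‖A‖ ^ p) := by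
        refine Finset.sum_le_sum fun l _ => ?_
        by_cases h : absEigenspace A l = ⊥
        · have h0 : Module.finrank ℂ (absEigenspace A l) = 0 := by rw [h]; exact finrank_bot ℂ H
          rw [h0]; simp
        · have hl : (0 : ℝ) < l := l.2
          gcongr
          exact le_norm_of_absEigenspace_ne_bot l.2 h
    _ = ((∑ l ∈ s, Module.finrank ℂ (absEigenspace A l) : ℕ) : ℝ≥0∞) *
          ENNReal.ofReal (‖A‖ ^ p) := by rw [← Finset.sum_mul]; push_cast; rfl
    _ ≤ _ := by
        gcongr
        exact sum_finrank_le_of_iSupIndep _ (iSupIndep_absEigenspace A) _ hle s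

theorem finiteDimensional_absEigenspace {A : H →L[ℂ] H} (hA : IsCompactOperator A) {l : ℝ}
    (hl : 0 < l) : FiniteDimensional ℂ (absEigenspace A l) := by
  have hc : IsCompactOperator (star A * A : H →L[ℂ] H) := hA.clm_comp (star A)
  have := ContinuousLinearMap.finite_dimensional_eigenspace hc ((l ^ 2 : ℝ) : ℂ)
    (by exact_mod_cast (pow_pos hl 2).ne')
  refine Submodule.finiteDimensional_of_le (S₂ := Module.End.eigenspace
    (star A * A : H →L[ℂ] H).toLinearMap ((l ^ 2 : ℝ) : ℂ)) fun y hy => ?_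
  rw [mem_eigenspace_abs_iff A hl] at hy
  rw [Module.End.mem_eigenspace_iff]
  exact hy

/-- A symmetric operator bounded below by `r ^ 2 > 0` on a finite-dimensional space: the dimension
is the sum of the multiplicities of the squares of finitely many numbers `l ≥ r`. -/
theorem exists_finrank_eq_sum_finrank_eigenspace {V : Type*} [NormedAddCommGroup V]
    [InnerProductSpace ℂ V] [FiniteDimensional ℂ V] {S : V →ₗ[ℂ] V} (hS : S.IsSymmetric) {r : ℝ}
    (hr : 0 < r) (hlow : ∀ v, r ^ 2 * ‖v‖ ^ 2 ≤ RCLike.re ⟪v, S v⟫_ℂ) :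
    ∃ s : Finset (Set.Ioi (0 : ℝ)), (∀ l ∈ s, r ≤ l) ∧ Module.finrank ℂ V =
      ∑ l ∈ s, Module.finrank ℂ (Module.End.eigenspace S (((l : ℝ) ^ 2 : ℝ) : ℂ)) := by
  obtain ⟨n, hn⟩ : ∃ n, Module.finrank ℂ V = n := ⟨_, rfl⟩
  obtain ⟨ev, hev⟩ : ∃ ev, ev = hS.eigenvalues hn := ⟨_, rfl⟩
  have hlow' : ∀ i, r ^ 2 ≤ ev i := by
    intro i
    have hv1 : ‖hS.eigenvectorBasis hn i‖ = 1 := (hS.eigenvectorBasis hn).orthonormal.1 i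
    have h := hlow (hS.eigenvectorBasis hn i)
    rw [hS.apply_eigenvectorBasis hn, inner_smul_right, inner_self_eq_norm_sq_to_K, hv1] at h
    rw [hev]
    simpa using h
  -- The `n` indices are grouped by the value of `√(ev i)`; each fibre has as many elements as the
  -- eigenspace has dimensions.
  let L : Fin n → Set.Ioi (0 : ℝ) := fun i =>
    ⟨√(ev i), Real.sqrt_pos.2 (lt_of_lt_of_le (pow_pos hr 2) (hlow' i))⟩
  classical
  refine ⟨Finset.univ.image L, ?_, ?_⟩
  · intro l hl
    obtain ⟨i, -, rfl⟩ := Finset.mem_image.1 hl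
    exact Real.le_sqrt_of_sq_le (hlow' i)
  · calc Module.finrank ℂ V = (Finset.univ : Finset (Fin n)).card := by
          rw [Finset.card_univ, Fintype.card_fin, hn]
      _ = ∑ l ∈ Finset.univ.image L, (Finset.univ.filter fun i => L i = l).card :=
          Finset.card_eq_sum_card_image L _
      _ = _ := by
          refine Finset.sum_congr rfl fun l _ => ?_
          have hl : (0 : ℝ) < l := l.2
          rw [← hS.card_filter_eigenvalues_eq hn, ← hev]
          congr 1
          ext i
          have h0 : 0 ≤ ev i := (sq_nonneg r).trans (hlow' i)
          simp only [Finset.mem_filter, Finset.mem_univ, true_and, L, Subtype.ext_iff]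
          rw [Real.sqrt_eq_iff_eq_sq h0 hl.le]
          exact Complex.ofReal_inj.symm

/-- If `T` is bounded below by `r` on a reducing subspace of dimension `d`, then
`d r ^ p ≤ ∑ λ_j ^ p`. -/
theorem finrank_mul_le_schattenSum {p : ℝ} (hp : 1 ≤ p) {T : H →L[ℂ] H}
    (hT : IsCompactOperator T) {r : ℝ} (hr : 0 < r) (W : Submodule ℂ H) [FiniteDimensional ℂ W]
    (hW : ∀ y ∈ W, (star T * T).toLinearMap y ∈ W) (hlow : ∀ y ∈ W, r * ‖y‖ ≤ ‖T y‖) :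
    Module.finrank ℂ W * ENNReal.ofReal (r ^ p) ≤ schattenSum p T := by
  have hsymm : (star T * T).toLinearMap.IsSymmetric :=
    (IsSelfAdjoint.star_mul_self T).isSymmetric
  have hS := hsymm.restrict_invariant hW
  obtain ⟨s, hs, hsum⟩ := exists_finrank_eq_sum_finrank_eigenspace hS hr (fun v => by
    have h1 : ⟪v, (star T * T).toLinearMap.restrict hW v⟫_ℂ = ((‖T v‖ ^ 2 : ℝ) : ℂ) := by
      rw [Submodule.coe_inner, LinearMap.coe_restrict_apply]
      change ⟪(v : H), star T (T v)⟫_ℂ = _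
      rw [ContinuousLinearMap.star_eq_adjoint, ContinuousLinearMap.adjoint_inner_right,
        inner_self_eq_norm_sq_to_K]
      push_cast; rfl
    rw [h1, ← mul_pow]
    have h2 := hlow v v.2
    have h3 : (r * ‖v‖) ^ 2 ≤ ‖T v‖ ^ 2 := pow_le_pow_left₀ (by positivity) h2 2
    exact h3)
  have hcard : ∀ l : Set.Ioi (0 : ℝ), Module.finrank ℂ (Module.End.eigenspace
      ((star T * T).toLinearMap.restrict hW) (((l : ℝ) ^ 2 : ℝ) : ℂ)) ≤
      Module.finrank ℂ (absEigenspace T l) := by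
    intro l
    have hl : (0 : ℝ) < l := l.2
    have hfd := finiteDimensional_absEigenspace hT hl
    rw [← Submodule.finrank_map_subtype_eq]
    refine Submodule.finrank_mono ?_
    rintro _ ⟨y, hy, rfl⟩
    rw [mem_eigenspace_abs_iff T hl]
    exact congrArg Subtype.val (Module.End.mem_eigenspace_iff.1 hy)
  calc (Module.finrank ℂ W : ℝ≥0∞) * ENNReal.ofReal (r ^ p)
      = ∑ l ∈ s, (Module.finrank ℂ (Module.End.eigenspace
          ((star T * T).toLinearMap.restrict hW) (((l : ℝ) ^ 2 : ℝ) : ℂ)) : ℝ≥0∞) *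
          ENNReal.ofReal (r ^ p) := by
        rw [← Finset.sum_mul, hsum, Nat.cast_sum]
    _ ≤ ∑ l ∈ s, (Module.finrank ℂ (absEigenspace T l) : ℝ≥0∞) *
          ENNReal.ofReal ((l : ℝ) ^ p) := by
        refine Finset.sum_le_sum fun l hl => ?_
        gcongr
        · exact hcard l
        · exact hs l hl
    _ ≤ _ := ENNReal.sum_le_tsum _

/-- Two operators whose absolute values have the same eigenspaces, except for the eigenvalue `1`,
have finite Schatten norms together. -/
theorem schattenSum_lt_top_of_absEigenspace_le {p : ℝ} {S T : H →L[ℂ] H}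
    (hT : IsCompactOperator T) (hTp : schattenSum p T < ∞)
    (h : ∀ l : ℝ, 0 < l → l ≠ 1 → absEigenspace S l ≤ absEigenspace T l) :
    schattenSum p S < ∞ := by
  classical
  let one : Set.Ioi (0 : ℝ) := ⟨1, Set.mem_Ioi.2 one_pos⟩
  -- The exceptional eigenvalue contributes one term, finite because `finrank` is a natural number.
  have hle : schattenSum p S ≤ schattenSum p T + ∑' l : Set.Ioi (0 : ℝ),
      if l = one then (Module.finrank ℂ (absEigenspace S 1) : ℝ≥0∞) else 0 := by
    rw [schattenSum, schattenSum, ← ENNReal.tsum_add]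
    refine ENNReal.tsum_le_tsum fun l => ?_
    have hl : (0 : ℝ) < l := l.2
    by_cases hl1 : l = one
    · subst hl1
      simp [one]
    · rw [if_neg hl1, add_zero]
      have := finiteDimensional_absEigenspace hT hl
      gcongr
      exact Submodule.finrank_mono (h l hl fun h1 => hl1 (Subtype.ext h1))
  refine hle.trans_lt (ENNReal.add_lt_top.2 ⟨hTp, ?_⟩)
  rw [tsum_ite_eq]
  exact ENNReal.natCast_lt_top _

/-- `U` maps each eigenspace of `|U* S U|` isomorphically onto that of `|S|`. -/
theorem schattenSum_unitary_conj (p : ℝ) {S U : H →L[ℂ] H} (hU : U ∈ unitary (H →L[ℂ] H)) :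
    schattenSum p (star U * S * U) = schattenSum p S := by
  have hUU : U * star U = 1 := Unitary.mul_star_self_of_mem hU
  have hUU' : star U * U = 1 := Unitary.star_mul_self_of_mem hU
  have e1 : ∀ y, U (star U y) = y := fun y => congrArg (fun B : H →L[ℂ] H => B y) hUU
  have e2 : ∀ y, star U (U y) = y := fun y => congrArg (fun B : H →L[ℂ] H => B y) hUU'
  let e : H ≃ₗ[ℂ] H :=
    { U.toLinearMap with
      invFun := (star U : H →L[ℂ] H)
      left_inv := e2
      right_inv := e1 }
  refine tsum_congr fun l => ?_
  have hl : (0 : ℝ) < l := l.2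
  have hS : star (star U * S * U) * (star U * S * U) = star U * (star S * S) * U := by
    simp only [star_mul, star_star, mul_assoc]
    rw [← mul_assoc U (star U), hUU, one_mul]
  have hmap : (absEigenspace (star U * S * U) l).map e.toLinearMap = absEigenspace S l := by
    ext y
    rw [Submodule.mem_map_equiv, mem_eigenspace_abs_iff _ hl, mem_eigenspace_abs_iff _ hl, hS]
    change star U ((star S * S) (U (star U y))) = _ • star U y ↔ _
    rw [e1, ← map_smul]
    exact ⟨fun h => by rw [← e1 ((star S * S) y), h, e1], fun h => by rw [h]⟩
  rw [← hmap, LinearEquiv.finrank_map_eq]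

end

/-! ### Functional calculus of compact normal operators, split at radius `r`. -/

section

variable {H : Type*} [NormedAddCommGroup H] [InnerProductSpace ℂ H] [CompleteSpace H]

theorem exists_unit_eigenvector {T : H →L[ℂ] H} (hc : IsCompactOperator T) {z : ℂ} (hz : z ≠ 0)
    (hzT : z ∈ spectrum ℂ T) : ∃ x : H, ‖x‖ = 1 ∧ T x = z • x := by
  obtain ⟨y, hy⟩ := ((hc.hasEigenvalue_iff_mem_spectrum hz).2 hzT).exists_hasEigenvector
  have hy0 : (‖y‖ : ℂ) ≠ 0 := by exact_mod_cast norm_ne_zero_iff.2 hy.2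
  have hyT : T y = z • y := hy.apply_eq_smul
  refine ⟨(‖y‖ : ℂ)⁻¹ • y, norm_smul_inv_norm hy.2, ?_⟩
  rw [map_smul, hyT, smul_comm]

/-- Since `T - z` is normal, its kernel is that of its adjoint, so `T* x = z̄ x`. -/
theorem inner_eq_zero_of_eigenvalue_ne {T : H →L[ℂ] H} (hT : IsStarNormal T) {z w : ℂ} {x y : H}
    (hx : T x = z • x) (hy : T y = w • y) (hzw : z ≠ w) : ⟪x, y⟫_ℂ = 0 := by
  have hN : IsStarNormal (T - z • (1 : H →L[ℂ] H)) := by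
    refine ⟨?_⟩
    have h := hT.star_comm_self
    rw [star_sub, star_smul, star_one]
    exact (h.sub_right ((Commute.one_right _).smul_right z)).sub_left
      (((Commute.one_left _).smul_left _))
  have h1 : (T - z • (1 : H →L[ℂ] H)) x = 0 := by
    change T x - z • x = 0
    rw [hx, sub_self]
  rw [← ContinuousLinearMap.IsStarNormal.adjoint_apply_eq_zero_iff hN, ← ContinuousLinearMap.star_eq_adjoint, star_sub, star_smul,
    star_one] at h1
  have h2 : star T x = star z • x := sub_eq_zero.1 h1
  have h3 : ⟪star T x, y⟫_ℂ = ⟪x, T y⟫_ℂ := by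
    rw [ContinuousLinearMap.star_eq_adjoint, ContinuousLinearMap.adjoint_inner_left]
  rw [h2, hy, inner_smul_left, inner_smul_right] at h3
  have h4 : (z - w) * ⟪x, y⟫_ℂ = 0 := by
    rw [sub_mul, ← h3]; simp
  exact (mul_eq_zero.1 h4).resolve_left (sub_ne_zero.2 hzw)

/-- The numerical radius of a compact normal operator is its norm. -/
theorem norm_le_numericalRadius {T : H →L[ℂ] H} (hT : IsStarNormal T) (hc : IsCompactOperator T)
    (h0 : 0 < numericalRadius T) : ‖T‖ ≤ numericalRadius T := by
  rcases eq_or_ne T 0 with rfl | hT0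
  · simpa using h0.le
  have : Nontrivial (H →L[ℂ] H) := ⟨⟨T, 0, hT0⟩⟩
  -- By normality some spectral value has modulus `‖T‖`, and by compactness it is an eigenvalue.
  obtain ⟨z, hz, hzn⟩ := spectrum.exists_nnnorm_eq_spectralRadius T
  rw [hT.spectralRadius_eq_nnnorm] at hzn
  have hzn' : ‖z‖ = ‖T‖ := congrArg NNReal.toReal (ENNReal.coe_injective hzn)
  have hz0 : z ≠ 0 := by
    rw [← norm_pos_iff, hzn']; exact norm_pos_iff.2 hT0
  obtain ⟨x, hx, hxT⟩ := exists_unit_eigenvector hc hz0 hz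
  rw [← hzn']
  have h := norm_inner_le_numericalRadius T hx
  rwa [hxT, inner_smul_right, inner_self_eq_norm_sq_to_K, hx, norm_mul, RCLike.ofReal_one, one_pow,
    norm_one, mul_one] at h

/-- The spectrum of a compact normal operator accumulates at most at `0`. -/
theorem finite_spectrum_of_lt_norm {T : H →L[ℂ] H} (hT : IsStarNormal T) (hc : IsCompactOperator T)
    {r : ℝ} (hr : 0 < r) : {z ∈ spectrum ℂ T | r < ‖z‖}.Finite := by
  by_contra hinf
  let f := Set.Infinite.natEmbedding _ hinf
  have hev : ∀ n, ∃ x : H, ‖x‖ = 1 ∧ T x = ((f n : ℂ)) • x := fun n =>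
    exists_unit_eigenvector hc (norm_pos_iff.1 (hr.trans (f n).2.2)) (f n).2.1
  choose x hx hxT using hev
  -- Infinitely many such eigenvalues would give orthonormal eigenvectors with `r`-separated images,
  -- against compactness.
  have hsep : ∀ m n, m ≠ n → r ≤ ‖T (x m) - T (x n)‖ := by
    intro m n hmn
    have horth : ⟪x m, x n⟫_ℂ = 0 := inner_eq_zero_of_eigenvalue_ne hT (hxT m) (hxT n)
      fun h => hmn (f.injective (Subtype.ext h))
    have h0 : ⟪T (x m), T (x n)⟫_ℂ = 0 := by
      rw [hxT, hxT, inner_smul_left, inner_smul_right, horth]; simp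
    have h1 : ‖T (x m) - T (x n)‖ ^ 2 = ‖T (x m)‖ ^ 2 + ‖T (x n)‖ ^ 2 := by
      rw [@norm_sub_sq ℂ, h0]; simp
    have h2 : r ≤ ‖T (x m)‖ := by
      rw [hxT, norm_smul, hx, mul_one]; exact (f m).2.2.le
    refine pow_le_pow_iff_left₀ hr.le (norm_nonneg _) two_ne_zero |>.1 ?_
    rw [h1]
    nlinarith [sq_nonneg ‖T (x n)‖]
  obtain ⟨K, hK, hK'⟩ := hc.image_closedBall_subset_compact (f := T.toLinearMap) 1
  obtain ⟨y, -, ψ, hψ, hψy⟩ := hK.tendsto_subseq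
    (fun n => hK' ⟨x n, by simp [hx n], rfl⟩)
  have hC := hψy.cauchySeq
  rw [Metric.cauchySeq_iff'] at hC
  obtain ⟨N, hN⟩ := hC r hr
  have h1 := hN (N + 1) (Nat.le_succ N)
  rw [dist_eq_norm] at h1
  exact absurd (hsep _ _ fun h => absurd (hψ.injective h) (Nat.succ_ne_self N)) (not_le.2 h1)

/-- The spectrum is the union of a finite set outside the disk and a closed set inside, so `g` may
be arbitrary and only `k` need be continuous. -/
theorem continuousOn_spectrum_ite {T : H →L[ℂ] H} (hT : IsStarNormal T) (hc : IsCompactOperator T)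
    {r : ℝ} (hr : 0 < r) (g : ℂ → ℂ) {k : ℂ → ℂ} (hk : Continuous k) :
    ContinuousOn (fun z => if r < ‖z‖ then g z else k z) (spectrum ℂ T) := by
  have hfin := finite_spectrum_of_lt_norm hT hc hr
  have hcl : IsClosed {z ∈ spectrum ℂ T | ‖z‖ ≤ r} :=
    (spectrum.isClosed T).inter (isClosed_le continuous_norm continuous_const)
  have hun : spectrum ℂ T = {z ∈ spectrum ℂ T | r < ‖z‖} ∪ {z ∈ spectrum ℂ T | ‖z‖ ≤ r} := by
    ext z
    constructor
    · intro hz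
      exact (lt_or_ge r ‖z‖).imp (fun h => ⟨hz, h⟩) (fun h => ⟨hz, h⟩)
    · rintro (h | h) <;> exact h.1
  rw [hun, continuousOn_union_iff_of_isClosed hfin.isClosed hcl]
  refine ⟨hfin.continuousOn _, hk.continuousOn.congr fun z hz => ?_⟩
  exact if_neg (not_lt.2 hz.2)

/-- The spectral integral of `g` outside the closed disk of radius `r` and of `k` inside. -/
def splitCfc (r : ℝ) (g k : ℂ → ℂ) (T : H →L[ℂ] H) : H →L[ℂ] H :=
  cfc (fun z : ℂ => if r < ‖z‖ then g z else k z) T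

variable {T : H →L[ℂ] H} {r : ℝ}

theorem splitCfc_mul (hT : IsStarNormal T) (hc : IsCompactOperator T) (hr : 0 < r) (g g' : ℂ → ℂ)
    {k k' : ℂ → ℂ} (hk : Continuous k) (hk' : Continuous k') :
    splitCfc r g k T * splitCfc r g' k' T =
      splitCfc r (fun z => g z * g' z) (fun z => k z * k' z) T := by
  rw [splitCfc, splitCfc, splitCfc, ← cfc_mul _ _ T (continuousOn_spectrum_ite hT hc hr g hk)
    (continuousOn_spectrum_ite hT hc hr g' hk')]
  congr 1; ext z; split_ifs <;> rfl

theorem splitCfc_sub (hT : IsStarNormal T) (hc : IsCompactOperator T) (hr : 0 < r) (g g' : ℂ → ℂ)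
    {k k' : ℂ → ℂ} (hk : Continuous k) (hk' : Continuous k') :
    splitCfc r g k T - splitCfc r g' k' T =
      splitCfc r (fun z => g z - g' z) (fun z => k z - k' z) T := by
  rw [splitCfc, splitCfc, splitCfc, ← cfc_sub _ _ T (continuousOn_spectrum_ite hT hc hr g hk)
    (continuousOn_spectrum_ite hT hc hr g' hk')]
  congr 1; ext z; split_ifs <;> rfl

theorem star_splitCfc (g k : ℂ → ℂ) :
    star (splitCfc r g k T) = splitCfc r (fun z => star (g z)) (fun z => star (k z)) T := by
  rw [splitCfc, splitCfc, ← cfc_star]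
  congr 1; ext z; split_ifs <;> rfl

theorem splitCfc_id (hT : IsStarNormal T) : splitCfc r (fun z => z) (fun z => z) T = T := by
  simp only [splitCfc, ite_self]
  exact cfc_id' ℂ T

theorem splitCfc_congr {g g' k k' : ℂ → ℂ} (hg : ∀ z ∈ spectrum ℂ T, r < ‖z‖ → g z = g' z)
    (hk : ∀ z ∈ spectrum ℂ T, ‖z‖ ≤ r → k z = k' z) : splitCfc r g k T = splitCfc r g' k' T := by
  refine cfc_congr fun z hz => ?_
  by_cases h : r < ‖z‖
  · simp only [if_pos h]; exact hg z hz h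
  · simp only [if_neg h]; exact hk z hz (not_lt.1 h)

theorem norm_splitCfc_le {g k : ℂ → ℂ} {c : ℝ} (hc0 : 0 ≤ c)
    (hg : ∀ z ∈ spectrum ℂ T, r < ‖z‖ → ‖g z‖ ≤ c)
    (hk : ∀ z ∈ spectrum ℂ T, ‖z‖ ≤ r → ‖k z‖ ≤ c) : ‖splitCfc r g k T‖ ≤ c := by
  refine norm_cfc_le hc0 fun z hz => ?_
  split_ifs with h
  · exact hg z hz h
  · exact hk z hz (not_lt.1 h)

theorem outerProj_eq : outerProj r T = splitCfc r (fun _ => 1) (fun _ => 0) T := rfl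

theorem outerPart_eq : outerPart r T = splitCfc r (fun z => z / (‖z‖ : ℂ)) (fun _ => 0) T := rfl

theorem innerPart_eq : innerPart r T = splitCfc r (fun _ => 0) (fun z => z) T := by
  rw [innerPart, splitCfc]
  congr 1; ext z
  by_cases h : r < ‖z‖
  · rw [if_pos h, if_neg (not_le.2 h)]
  · rw [if_neg h, if_pos (not_lt.1 h)]

/-- The inverse of `T` on the range of `outerProj r T`. -/
def outerInv (r : ℝ) (T : H →L[ℂ] H) : H →L[ℂ] H :=
  splitCfc r (fun z => z⁻¹) (fun _ => 0) T

theorem star_outerProj : star (outerProj r T) = outerProj r T := by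
  rw [outerProj_eq, star_splitCfc]; simp

theorem outerProj_mul_self (hT : IsStarNormal T) (hc : IsCompactOperator T) (hr : 0 < r) :
    outerProj r T * outerProj r T = outerProj r T := by
  rw [outerProj_eq, splitCfc_mul hT hc hr _ _ continuous_const continuous_const]; simp

theorem outerPart_mul_outerProj (hT : IsStarNormal T) (hc : IsCompactOperator T) (hr : 0 < r) :
    outerPart r T * outerProj r T = outerPart r T := by
  rw [outerPart_eq, outerProj_eq, splitCfc_mul hT hc hr _ _ continuous_const continuous_const]
  simp

theorem outerProj_mul_outerPart (hT : IsStarNormal T) (hc : IsCompactOperator T) (hr : 0 < r) :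
    outerProj r T * outerPart r T = outerPart r T := by
  rw [outerPart_eq, outerProj_eq, splitCfc_mul hT hc hr _ _ continuous_const continuous_const]
  simp

theorem star_outerPart_mul_outerPart (hT : IsStarNormal T) (hc : IsCompactOperator T)
    (hr : 0 < r) : star (outerPart r T) * outerPart r T = outerProj r T := by
  rw [outerPart_eq, outerProj_eq, star_splitCfc,
    splitCfc_mul hT hc hr _ _ (by fun_prop) continuous_const]
  refine splitCfc_congr (fun z _ hz => ?_) (by simp)
  have hz0 : (‖z‖ : ℂ) ≠ 0 := by exact_mod_cast (hr.trans hz).ne'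
  change (starRingEnd ℂ) _ * _ = _
  rw [← Complex.normSq_eq_conj_mul_self, Complex.normSq_eq_norm_sq, norm_div, Complex.norm_real,
    norm_norm, div_self (hr.trans hz).ne']
  simp

theorem outerPart_mul_star_outerPart (hT : IsStarNormal T) (hc : IsCompactOperator T)
    (hr : 0 < r) : outerPart r T * star (outerPart r T) = outerProj r T := by
  rw [← star_outerPart_mul_outerPart hT hc hr, outerPart_eq, star_splitCfc,
    splitCfc_mul hT hc hr _ _ (by fun_prop) (by fun_prop),
    splitCfc_mul hT hc hr _ _ (by fun_prop) (by fun_prop)]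
  simp only [mul_comm]

theorem innerPart_mul_outerProj (hT : IsStarNormal T) (hc : IsCompactOperator T) (hr : 0 < r) :
    innerPart r T * outerProj r T = 0 := by
  rw [innerPart_eq, outerProj_eq, splitCfc_mul hT hc hr _ _ continuous_id' continuous_const]
  simp [splitCfc]

theorem outerProj_mul_innerPart (hT : IsStarNormal T) (hc : IsCompactOperator T) (hr : 0 < r) :
    outerProj r T * innerPart r T = 0 := by
  rw [innerPart_eq, outerProj_eq, splitCfc_mul hT hc hr _ _ continuous_const continuous_id']
  simp [splitCfc]

theorem isStarNormal_innerPart : IsStarNormal (innerPart r T) := cfc_predicate _ _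

theorem mul_outerProj (hT : IsStarNormal T) (hc : IsCompactOperator T) (hr : 0 < r) :
    T * outerProj r T = T - innerPart r T := by
  rw [innerPart_eq, outerProj_eq]
  nth_rewrite 1 3 [← splitCfc_id (r := r) hT]
  rw [splitCfc_mul hT hc hr _ _ continuous_id' continuous_const,
    splitCfc_sub hT hc hr _ _ continuous_id' continuous_id']
  simp

theorem outerProj_mul (hT : IsStarNormal T) (hc : IsCompactOperator T) (hr : 0 < r) :
    outerProj r T * T = T - innerPart r T := by
  rw [innerPart_eq, outerProj_eq]
  nth_rewrite 2 3 [← splitCfc_id (r := r) hT]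
  rw [splitCfc_mul hT hc hr _ _ continuous_const continuous_id',
    splitCfc_sub hT hc hr _ _ continuous_id' continuous_id']
  simp

theorem outerInv_mul (hT : IsStarNormal T) (hc : IsCompactOperator T) (hr : 0 < r) :
    outerInv r T * T = outerProj r T := by
  rw [outerInv, outerProj_eq]
  nth_rewrite 2 [← splitCfc_id (r := r) hT]
  rw [splitCfc_mul hT hc hr _ _ continuous_const continuous_id']
  refine splitCfc_congr (fun z _ hz => ?_) (by simp)
  exact inv_mul_cancel₀ (norm_pos_iff.1 (hr.trans hz))

theorem norm_outerInv_le (hr : 0 < r) : ‖outerInv r T‖ ≤ r⁻¹ := by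
  refine norm_splitCfc_le (by positivity) (fun z _ hz => ?_) (fun z _ _ => ?_)
  · rw [norm_inv]; gcongr
  · simpa using hr.le

theorem norm_innerPart_le (hr : 0 < r) : ‖innerPart r T‖ ≤ r := by
  rw [innerPart_eq]
  exact norm_splitCfc_le hr.le (fun z _ _ => by simpa using hr.le) (fun z _ hz => hz)

/-- On the spectrum outside the disk, `|z / |z| - z| = 1 - |z| < 1 - r`. -/
theorem norm_outerPart_sub_le (hT : IsStarNormal T) (hc : IsCompactOperator T) (hr : 0 < r)
    (hr1 : r ≤ 1) (hT1 : ‖T‖ ≤ 1) : ‖outerPart r T - T * outerProj r T‖ ≤ 1 - r := by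
  rcases subsingleton_or_nontrivial H with hH | hH
  · have : outerPart r T - T * outerProj r T = 0 := Subsingleton.elim _ _
    rw [this, norm_zero]; linarith
  have h : outerPart r T - T * outerProj r T =
      splitCfc r (fun z => z / (‖z‖ : ℂ) - z) (fun _ => 0) T := by
    rw [outerPart_eq, outerProj_eq]
    nth_rewrite 2 [← splitCfc_id (r := r) hT]
    rw [splitCfc_mul hT hc hr _ _ continuous_id' continuous_const,
      splitCfc_sub hT hc hr _ _ continuous_const (by fun_prop)]
    simp
  rw [h]
  refine norm_splitCfc_le (by linarith) (fun z hz hrz => ?_) (fun z _ _ => by simpa using hr1)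
  have hz0 : 0 < ‖z‖ := hr.trans hrz
  have hzc : (‖z‖ : ℂ) ≠ 0 := by exact_mod_cast hz0.ne'
  have hz1 : ‖z‖ ≤ 1 := (spectrum.norm_le_norm_of_mem hz).trans hT1
  have h1 : z / (‖z‖ : ℂ) - z = z / (‖z‖ : ℂ) * ((1 - ‖z‖ : ℝ) : ℂ) := by
    push_cast; field_simp
  rw [h1, norm_mul, norm_div, Complex.norm_real, Complex.norm_real, norm_norm, div_self hz0.ne',
    one_mul, Real.norm_of_nonneg (by linarith)]
  linarith

theorem isCompactOperator_outerProj (hT : IsStarNormal T) (hc : IsCompactOperator T)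
    (hr : 0 < r) : IsCompactOperator (outerProj r T) := by
  rw [← outerInv_mul hT hc hr]
  exact hc.clm_comp (outerInv r T)

theorem le_norm_apply_of_outerProj (hT : IsStarNormal T) (hc : IsCompactOperator T) (hr : 0 < r)
    {y : H} (hy : outerProj r T y = y) : r * ‖y‖ ≤ ‖T y‖ := by
  have h1 : ‖y‖ ≤ r⁻¹ * ‖T y‖ := by
    calc ‖y‖ = ‖outerInv r T (T y)‖ := by
          nth_rewrite 1 [← hy, ← outerInv_mul hT hc hr]; rfl
      _ ≤ ‖outerInv r T‖ * ‖T y‖ := ContinuousLinearMap.le_opNorm _ _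
      _ ≤ r⁻¹ * ‖T y‖ := by gcongr; exact norm_outerInv_le hr
  rwa [← div_eq_inv_mul, le_div_iff₀ hr, mul_comm] at h1

end

/-! ### The operator `R* N₁ + N₂`. -/

section

variable {H : Type*} [NormedAddCommGroup H] [InnerProductSpace ℂ H] [CompleteSpace H]
  {T : H →L[ℂ] H} {r : ℝ}

theorem splitCfc_add (hT : IsStarNormal T) (hc : IsCompactOperator T) (hr : 0 < r) (g g' : ℂ → ℂ)
    {k k' : ℂ → ℂ} (hk : Continuous k) (hk' : Continuous k') :
    splitCfc r g k T + splitCfc r g' k' T =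
      splitCfc r (fun z => g z + g' z) (fun z => k z + k' z) T := by
  rw [splitCfc, splitCfc, splitCfc, ← cfc_add T _ _ (continuousOn_spectrum_ite hT hc hr g hk)
    (continuousOn_spectrum_ite hT hc hr g' hk')]
  congr 1; ext z; split_ifs <;> rfl

theorem norm_outerProj_add_le (hT : IsStarNormal T) (hc : IsCompactOperator T) (hr : 0 < r)
    (hr1 : r ≤ 1) : ‖outerProj r T + star (innerPart r T) * innerPart r T‖ ≤ 1 := by
  rw [innerPart_eq, outerProj_eq, star_splitCfc,
    splitCfc_mul hT hc hr _ _ (by fun_prop) (by fun_prop),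
    splitCfc_add hT hc hr _ _ (by fun_prop) (by fun_prop)]
  refine norm_splitCfc_le zero_le_one (fun z _ _ => by simp) (fun z _ hz => ?_)
  rw [zero_add, norm_mul, norm_star]
  have h0 := norm_nonneg z
  nlinarith

/-- The operator `R* N₁ + N₂`. -/
def rotatedSum (r : ℝ) (T R : H →L[ℂ] H) : H →L[ℂ] H :=
  star R * outerPart r T + innerPart r T

section Rotated

variable {R : H →L[ℂ] H}

theorem mul_one_sub_outerProj (hT : IsStarNormal T) (hc : IsCompactOperator T) (hr : 0 < r)
    (hfix : ∀ y, outerProj r T y = 0 → R y = y) :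
    R * (1 - outerProj r T) = 1 - outerProj r T := by
  ext y
  refine hfix ((1 - outerProj r T) y) ?_
  have h : outerProj r T * (1 - outerProj r T) = 0 := by
    rw [mul_sub, mul_one, outerProj_mul_self hT hc hr, sub_self]
  exact congrArg (fun A : H →L[ℂ] H => A y) h

/-- Both `R` and `R*` are the identity on `ker P`; taking adjoints gives `(1 - P) R = 1 - P = R (1 -
P)`. -/
theorem commute_outerProj (hT : IsStarNormal T) (hc : IsCompactOperator T) (hr : 0 < r)
    (hR : R ∈ unitary (H →L[ℂ] H)) (hfix : ∀ y, outerProj r T y = 0 → R y = y) :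
    R * outerProj r T = outerProj r T * R := by
  have h1 := mul_one_sub_outerProj hT hc hr hfix
  have h2 : star R * (1 - outerProj r T) = 1 - outerProj r T := by
    nth_rewrite 1 [← h1]
    rw [← mul_assoc, Unitary.star_mul_self_of_mem hR, one_mul]
  have h3 := congrArg star h2
  rw [star_mul, star_star, star_sub, star_one, star_outerProj] at h3
  rw [mul_sub, mul_one] at h1
  rw [sub_mul, one_mul, ← h1] at h3
  exact (sub_right_injective h3).symm

theorem mul_innerPart_of_fix (hT : IsStarNormal T) (hc : IsCompactOperator T) (hr : 0 < r)
    (hfix : ∀ y, outerProj r T y = 0 → R y = y) : R * innerPart r T = innerPart r T := by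
  ext y
  exact hfix _ (congrArg (fun A : H →L[ℂ] H => A y) (outerProj_mul_innerPart hT hc hr))

theorem star_outerPart_mul_innerPart (hT : IsStarNormal T) (hc : IsCompactOperator T)
    (hr : 0 < r) : star (outerPart r T) * innerPart r T = 0 := by
  rw [← outerProj_mul_outerPart hT hc hr, star_mul, star_outerProj, mul_assoc,
    outerProj_mul_innerPart hT hc hr, mul_zero]

theorem outerProj_mul_star_innerPart (hT : IsStarNormal T) (hc : IsCompactOperator T)
    (hr : 0 < r) : outerProj r T * star (innerPart r T) = 0 := by
  have h := congrArg star (innerPart_mul_outerProj hT hc hr)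
  rwa [star_mul, star_outerProj, star_zero] at h

theorem outerPart_mul_star_innerPart (hT : IsStarNormal T) (hc : IsCompactOperator T)
    (hr : 0 < r) : outerPart r T * star (innerPart r T) = 0 := by
  rw [← outerPart_mul_outerProj hT hc hr, mul_assoc, outerProj_mul_star_innerPart hT hc hr,
    mul_zero]

theorem star_rotatedSum_mul_self (hT : IsStarNormal T) (hc : IsCompactOperator T) (hr : 0 < r)
    (hR : R ∈ unitary (H →L[ℂ] H)) (hfix : ∀ y, outerProj r T y = 0 → R y = y) :
    star (rotatedSum r T R) * rotatedSum r T R =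
      outerProj r T + star (innerPart r T) * innerPart r T := by
  have h1 : star (outerPart r T) * R * (star R * outerPart r T) = outerProj r T := by
    rw [mul_assoc, ← mul_assoc R, Unitary.mul_star_self_of_mem hR, one_mul,
      star_outerPart_mul_outerPart hT hc hr]
  have h2 : star (outerPart r T) * R * innerPart r T = 0 := by
    rw [mul_assoc, mul_innerPart_of_fix hT hc hr hfix, star_outerPart_mul_innerPart hT hc hr]
  have h3 : star (innerPart r T) * (star R * outerPart r T) = 0 := by
    have h := congrArg star h2
    rwa [star_mul, star_mul, star_star, star_zero] at h
  rw [rotatedSum, star_add, star_mul, star_star, add_mul, mul_add, mul_add, h1, h2, h3, add_zero,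
    zero_add]

theorem rotatedSum_mul_star_self (hT : IsStarNormal T) (hc : IsCompactOperator T) (hr : 0 < r)
    (hR : R ∈ unitary (H →L[ℂ] H)) (hfix : ∀ y, outerProj r T y = 0 → R y = y) :
    rotatedSum r T R * star (rotatedSum r T R) =
      outerProj r T + innerPart r T * star (innerPart r T) := by
  have h1 : star R * outerPart r T * (star (outerPart r T) * R) = outerProj r T := by
    rw [mul_assoc, ← mul_assoc (outerPart r T), outerPart_mul_star_outerPart hT hc hr,
      ← commute_outerProj hT hc hr hR hfix, ← mul_assoc, Unitary.star_mul_self_of_mem hR, one_mul]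
  have h2 : star R * outerPart r T * star (innerPart r T) = 0 := by
    rw [mul_assoc, outerPart_mul_star_innerPart hT hc hr, mul_zero]
  have h3 : innerPart r T * (star (outerPart r T) * R) = 0 := by
    have h := congrArg star h2
    rwa [star_mul, star_mul, star_star, star_star, star_zero] at h
  rw [rotatedSum, star_add, star_mul, star_star, add_mul, mul_add, mul_add, h1, h2, h3, add_zero,
    zero_add]

theorem isStarNormal_rotatedSum (hT : IsStarNormal T) (hc : IsCompactOperator T) (hr : 0 < r)
    (hR : R ∈ unitary (H →L[ℂ] H)) (hfix : ∀ y, outerProj r T y = 0 → R y = y) :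
    IsStarNormal (rotatedSum r T R) := by
  refine ⟨?_⟩
  rw [Commute, SemiconjBy, star_rotatedSum_mul_self hT hc hr hR hfix,
    rotatedSum_mul_star_self hT hc hr hR hfix,
    (isStarNormal_innerPart (T := T) (r := r)).star_comm_self.eq]

theorem norm_rotatedSum_le (hT : IsStarNormal T) (hc : IsCompactOperator T) (hr : 0 < r)
    (hr1 : r ≤ 1) (hR : R ∈ unitary (H →L[ℂ] H)) (hfix : ∀ y, outerProj r T y = 0 → R y = y) :
    ‖rotatedSum r T R‖ ≤ 1 := by
  have h := CStarRing.norm_star_mul_self (x := rotatedSum r T R)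
  rw [star_rotatedSum_mul_self hT hc hr hR hfix] at h
  have h1 := norm_outerProj_add_le hT hc hr hr1
  rw [h] at h1
  nlinarith [norm_nonneg (rotatedSum r T R)]

theorem rotatedSum_sub (hT : IsStarNormal T) (hc : IsCompactOperator T) (hr : 0 < r) :
    rotatedSum r T R - T = star R * outerPart r T - T * outerProj r T := by
  rw [rotatedSum, mul_outerProj hT hc hr]; abel

/-- The perturbation lives on the finite-dimensional range of `P`; compactness of `S` and the
Schatten bound rest on this. -/
theorem rotatedSum_sub_mul_outerProj (hT : IsStarNormal T) (hc : IsCompactOperator T)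
    (hr : 0 < r) : (rotatedSum r T R - T) * outerProj r T = rotatedSum r T R - T := by
  rw [rotatedSum_sub hT hc hr, sub_mul, mul_assoc, mul_assoc, outerPart_mul_outerProj hT hc hr,
    outerProj_mul_self hT hc hr]

theorem isCompactOperator_rotatedSum (hT : IsStarNormal T) (hc : IsCompactOperator T)
    (hr : 0 < r) : IsCompactOperator (rotatedSum r T R) := by
  have h : rotatedSum r T R = (rotatedSum r T R - T) * outerProj r T + T := by
    rw [rotatedSum_sub_mul_outerProj hT hc hr, sub_add_cancel]
  rw [h]
  exact ((isCompactOperator_outerProj hT hc hr).clm_comp (rotatedSum r T R - T)).add hc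

theorem norm_rotatedSum_sub_le (hT : IsStarNormal T) (hc : IsCompactOperator T) (hr : 0 < r)
    (hr1 : r ≤ 1) (hT1 : ‖T‖ ≤ 1) : ‖rotatedSum r T R - T‖ ≤ ‖R - 1‖ + (1 - r) := by
  have h : rotatedSum r T R - T =
      star (R - 1) * outerPart r T + (outerPart r T - T * outerProj r T) := by
    rw [rotatedSum_sub hT hc hr, star_sub, star_one, sub_mul, one_mul]; abel
  have hN : ‖outerPart r T‖ ≤ 1 := by
    refine norm_splitCfc_le zero_le_one (fun z _ hz => ?_) (fun z _ _ => by simp)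
    rw [norm_div, Complex.norm_real, norm_norm, div_self (hr.trans hz).ne']
  calc ‖rotatedSum r T R - T‖ ≤ ‖star (R - 1) * outerPart r T‖ +
        ‖outerPart r T - T * outerProj r T‖ := by rw [h]; exact norm_add_le _ _
    _ ≤ ‖R - 1‖ * 1 + (1 - r) := by
        gcongr
        · exact (norm_mul_le _ _).trans (by rw [norm_star]; gcongr)
        · exact norm_outerPart_sub_le hT hc hr hr1 hT1
    _ = _ := by rw [mul_one]

/-- On the range of `P` the operator `S* S` is the identity, so `l ≠ 1` forces `P y = 0`; on `ker
P`, `S* S` and `T* T` agree. -/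
theorem absEigenspace_rotatedSum_le (hT : IsStarNormal T) (hc : IsCompactOperator T) (hr : 0 < r)
    (hR : R ∈ unitary (H →L[ℂ] H)) (hfix : ∀ y, outerProj r T y = 0 → R y = y) {l : ℝ}
    (hl : 0 < l) (hl1 : l ≠ 1) : absEigenspace (rotatedSum r T R) l ≤ absEigenspace T l := by
  intro y hy
  rw [mem_eigenspace_abs_iff _ hl] at hy ⊢
  rw [star_rotatedSum_mul_self hT hc hr hR hfix] at hy
  have h1 : outerProj r T * (outerProj r T + star (innerPart r T) * innerPart r T) =
      outerProj r T := by
    rw [mul_add, outerProj_mul_self hT hc hr, ← mul_assoc, outerProj_mul_star_innerPart hT hc hr,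
      zero_mul, add_zero]
  have h2 : outerProj r T ((outerProj r T + star (innerPart r T) * innerPart r T) y) =
      outerProj r T y := congrArg (fun A : H →L[ℂ] H => A y) h1
  rw [hy, map_smul] at h2
  have h3 : outerProj r T y = 0 := by
    by_contra h0
    have h4 : (((l ^ 2 : ℝ) : ℂ) - 1) • outerProj r T y = 0 := by
      rw [sub_smul, h2, one_smul, sub_self]
    rcases smul_eq_zero.1 h4 with h5 | h5
    · have h6 : l ^ 2 = 1 := by exact_mod_cast sub_eq_zero.1 h5
      exact hl1 (by nlinarith)
    · exact h0 h5
  have h5 : T * outerProj r T + innerPart r T = T := by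
    rw [mul_outerProj hT hc hr, sub_add_cancel]
  have h6 : star T * innerPart r T = star (innerPart r T) * innerPart r T := by
    have h7 : star T = star T * outerProj r T + star (innerPart r T) := by
      have h8 := congrArg star (outerProj_mul hT hc hr)
      rw [star_mul, star_outerProj, star_sub] at h8
      rw [h8, sub_add_cancel]
    rw [h7, add_mul, mul_assoc, outerProj_mul_innerPart hT hc hr, mul_zero, zero_add]
  have h9 : T y = innerPart r T y := by
    nth_rewrite 1 [← h5]
    change T (outerProj r T y) + innerPart r T y = _
    rw [h3, map_zero, zero_add]
  have h10 : outerProj r T y + (star (innerPart r T) * innerPart r T) y =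
    ((l ^ 2 : ℝ) : ℂ) • y := hy
  rw [h3, zero_add, ← h6] at h10
  rw [← h10]
  change star T (T y) = star T (innerPart r T y)
  rw [h9]

end Rotated

end

/-! ### Estimates at `x₀` and the choice of the rotation. -/

section

variable {H : Type*} [NormedAddCommGroup H] [InnerProductSpace ℂ H] [CompleteSpace H]

theorem inner_apply_left_of_star_eq {P : H →L[ℂ] H} (hP : star P = P) (x y : H) :
    ⟪P x, y⟫_ℂ = ⟪x, P y⟫_ℂ := by
  nth_rewrite 1 [← hP]
  rw [ContinuousLinearMap.star_eq_adjoint, ContinuousLinearMap.adjoint_inner_left]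

/-- If `T` almost attains its norm `1` at `x₀`, then `x₀` is close to the range of
`P = E(σ(T) \ B(1 - s))` and `N₁` almost attains its numerical radius at `P x₀`. -/
theorem outerProj_estimates {T : H →L[ℂ] H} (hT : IsStarNormal T) (hc : IsCompactOperator T)
    (hT1 : ‖T‖ ≤ 1) {s : ℝ} (hs0 : 0 < s) (hs1 : s < 1) {x₀ : H} (hx₀ : ‖x₀‖ = 1)
    (h : 1 - s ^ 2 / 2 < ‖⟪x₀, T x₀⟫_ℂ‖) :
    1 - s / 2 < ‖outerProj (1 - s) T x₀‖ ^ 2 ∧ ‖outerProj (1 - s) T x₀‖ ≤ 1 ∧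
      (1 - s - s ^ 2 / 2) * ‖outerProj (1 - s) T x₀‖ ^ 2 ≤
        ‖⟪outerProj (1 - s) T x₀, outerPart (1 - s) T (outerProj (1 - s) T x₀)⟫_ℂ‖ := by
  have hr : 0 < 1 - s := by linarith
  have hr1 : 1 - s ≤ 1 := by linarith
  set P := outerProj (1 - s) T with hPdef
  have hPs : star P = P := star_outerProj
  have hPP : ∀ y, P (P y) = P y := fun y =>
    congrArg (fun A : H →L[ℂ] H => A y) (outerProj_mul_self hT hc hr)
  set a := P x₀ with ha
  set b := x₀ - a with hb
  have hab : ⟪a, b⟫_ℂ = 0 := by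
    rw [ha, inner_apply_left_of_star_eq hPs, hb, map_sub, ha, hPP, sub_self, inner_zero_right]
  have hx : x₀ = a + b := by rw [hb]; abel
  have hpyth : ‖a‖ ^ 2 + ‖b‖ ^ 2 = 1 := by
    have h1 := @norm_add_sq ℂ H _ _ _ a b
    rw [← hx, hx₀, hab] at h1
    simp at h1
    linarith
  have hTa : P (T x₀) = T a := by
    have h1 := (outerProj_mul hT hc hr).trans (mul_outerProj hT hc hr).symm
    exact congrArg (fun A : H →L[ℂ] H => A x₀) h1
  have hNa : innerPart (1 - s) T a = 0 :=
    congrArg (fun A : H →L[ℂ] H => A x₀) (innerPart_mul_outerProj hT hc hr)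
  have hPN : ∀ y, P (innerPart (1 - s) T y) = 0 := fun y =>
    congrArg (fun A : H →L[ℂ] H => A y) (outerProj_mul_innerPart hT hc hr)
  have hTx : T x₀ = T a + innerPart (1 - s) T b := by
    have h1 : T a = T x₀ - innerPart (1 - s) T x₀ :=
      congrArg (fun A : H →L[ℂ] H => A x₀) (mul_outerProj hT hc hr)
    rw [hb, map_sub, hNa, sub_zero, h1, sub_add_cancel]
  have hin : ⟪x₀, T x₀⟫_ℂ = ⟪a, T a⟫_ℂ + ⟪b, innerPart (1 - s) T b⟫_ℂ := by
    rw [hTx, inner_add_right]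
    congr 1
    · have h1 : P (T a) = T a := by rw [← hTa, hPP]
      rw [← h1, ← inner_apply_left_of_star_eq hPs, h1]
    · have h1 : ⟪a, innerPart (1 - s) T b⟫_ℂ = 0 := by
        rw [ha, inner_apply_left_of_star_eq hPs, hPN, inner_zero_right]
      rw [hb, inner_sub_left, h1, sub_zero]
  have hquad : ∀ (A : H →L[ℂ] H) (c : ℝ) (y : H), ‖A‖ ≤ c → ‖⟪y, A y⟫_ℂ‖ ≤ c * ‖y‖ ^ 2 := by
    intro A c y hA
    calc ‖⟪y, A y⟫_ℂ‖ ≤ ‖y‖ * ‖A y‖ := norm_inner_le_norm _ _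
      _ ≤ ‖y‖ * (c * ‖y‖) := by gcongr; exact A.le_of_opNorm_le hA y
      _ = c * ‖y‖ ^ 2 := by ring
  have h1 : ‖⟪x₀, T x₀⟫_ℂ‖ ≤ ‖⟪a, T a⟫_ℂ‖ + (1 - s) * ‖b‖ ^ 2 := by
    rw [hin]
    exact (norm_add_le _ _).trans (by gcongr; exact hquad _ _ _ (norm_innerPart_le hr))
  have h2 : ‖⟪a, T a⟫_ℂ‖ ≤ ‖a‖ ^ 2 := by simpa using hquad T 1 a hT1
  have h3 : ‖⟪a, T a⟫_ℂ‖ ≤ ‖⟪a, outerPart (1 - s) T a⟫_ℂ‖ + s * ‖a‖ ^ 2 := by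
    have h4 := hquad (outerPart (1 - s) T - T * P) s a
      (by simpa using norm_outerPart_sub_le hT hc hr hr1 hT1)
    have h5 : (outerPart (1 - s) T - T * P) a = outerPart (1 - s) T a - T a := by
      change outerPart (1 - s) T a - T (P a) = _
      rw [ha, hPP]
    rw [h5, inner_sub_right, norm_sub_rev] at h4
    have h6 := norm_le_norm_add_norm_sub' (⟪a, T a⟫_ℂ) (⟪a, outerPart (1 - s) T a⟫_ℂ)
    linarith
  have hb0 := sq_nonneg ‖b‖
  refine ⟨?_, ?_, ?_⟩
  -- The inequalities give `1 - s² / 2 < ‖a‖² + (1 - s) ‖b‖² = 1 - s ‖b‖²`.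
  · nlinarith
  · nlinarith [norm_nonneg a]
  · have h7 : ‖a‖ ^ 2 ≤ 1 := by linarith
    -- The estimates leave a surplus of `s (1 - s / 2) (1 - ‖a‖²)`.
    nlinarith [mul_nonneg (mul_nonneg hs0.le (by linarith : (0 : ℝ) ≤ 1 - s / 2))
      (by linarith : (0 : ℝ) ≤ 1 - ‖a‖ ^ 2)]

/-- The unitary operator and the unit vector of the approximation. -/
theorem exists_rotation_attaining {T : H →L[ℂ] H} (hT : IsStarNormal T) (hc : IsCompactOperator T)
    (hT1 : ‖T‖ ≤ 1) {s : ℝ} (hs0 : 0 < s) (hs1 : s < 1) {x₀ : H} (hx₀ : ‖x₀‖ = 1)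
    (h : 1 - s ^ 2 / 2 < ‖⟪x₀, T x₀⟫_ℂ‖) :
    ∃ R ∈ unitary (H →L[ℂ] H), ∃ x₁ : H, ‖x₁‖ = 1 ∧
      (∀ y, outerProj (1 - s) T y = 0 → R y = y) ∧ ‖R - 1‖ ≤ √(2 * s + s ^ 2) ∧
      ‖⟪x₁, rotatedSum (1 - s) T R x₁⟫_ℂ‖ = 1 ∧ ‖x₁ - x₀‖ ≤ √s ∧
      ∃ c : ℝ, 0 ≤ c ∧ ⟪x₀, x₁⟫_ℂ = c := by
  have hr : 0 < 1 - s := by linarith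
  obtain ⟨e1, e2, e3⟩ := outerProj_estimates hT hc hT1 hs0 hs1 hx₀ h
  set P := outerProj (1 - s) T with hPdef
  have hPs : star P = P := star_outerProj
  have hPP : ∀ y, P (P y) = P y := fun y =>
    congrArg (fun A : H →L[ℂ] H => A y) (outerProj_mul_self hT hc hr)
  set N := outerPart (1 - s) T with hN
  set a := P x₀ with ha
  have ha0 : 0 < ‖a‖ := by
    rcases (norm_nonneg a).eq_or_lt with h0 | h0
    · rw [← h0] at e1; linarith
    · exact h0
  have hac : (‖a‖ : ℂ) ≠ 0 := by exact_mod_cast ha0.ne'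
  set x₁ : H := (‖a‖ : ℂ)⁻¹ • a with hx₁
  have hx₁n : ‖x₁‖ = 1 := norm_smul_inv_norm (norm_pos_iff.1 ha0)
  have hPx : P x₁ = x₁ := by rw [hx₁, map_smul, ha, hPP]
  have hxx : ⟪x₁, x₁⟫_ℂ = 1 := by rw [inner_self_eq_norm_sq_to_K, hx₁n]; simp
  have h01 : ⟪x₀, x₁⟫_ℂ = (‖a‖ : ℝ) := by
    have h1 : ⟪x₀, a⟫_ℂ = (‖a‖ : ℂ) ^ 2 := by
      rw [ha, ← hPP x₀, ← inner_apply_left_of_star_eq hPs, hPP, inner_self_eq_norm_sq_to_K]; rfl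
    rw [hx₁, inner_smul_right, h1]
    field_simp
  have hdist : ‖x₁ - x₀‖ ≤ √s := by
    refine Real.le_sqrt_of_sq_le ?_
    have h1 := @norm_sub_sq ℂ H _ _ _ x₀ x₁
    rw [h01, hx₀, hx₁n, norm_sub_rev] at h1
    have h2 : RCLike.re ((‖a‖ : ℝ) : ℂ) = ‖a‖ := Complex.ofReal_re _
    rw [h2] at h1
    -- `‖x₁ - x₀‖² = 2 - 2‖a‖ ≤ 2 - 2‖a‖² < s`, because `‖a‖ ≤ 1`.
    nlinarith
  set c : ℝ := ‖⟪x₁, N x₁⟫_ℂ‖ with hcdef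
  have hc1 : 1 - s - s ^ 2 / 2 ≤ c := by
    have h1 : c * ‖a‖ ^ 2 = ‖⟪a, N a⟫_ℂ‖ := by
      have h2 : a = (‖a‖ : ℂ) • x₁ := by rw [hx₁, smul_smul, mul_inv_cancel₀ hac, one_smul]
      nth_rewrite 2 3 [h2]
      rw [map_smul, inner_smul_left, inner_smul_right, norm_mul, norm_mul, RCLike.norm_conj,
        Complex.norm_real, norm_norm]
      ring
    rw [← h1] at e3
    exact le_of_mul_le_mul_right e3 (pow_pos ha0 2)
  -- The phase `u` makes the inner product of `x₁` with `w` real and nonnegative, as the rotation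
  -- requires.
  obtain ⟨u, hu, huc⟩ := Complex.exists_norm_eq_mul_self ⟪x₁, N x₁⟫_ℂ
  have hu0 : u ≠ 0 := by rw [← norm_pos_iff, hu]; exact one_pos
  set w : H := u • N x₁ with hw
  have hNN : ‖N x₁‖ = 1 := by
    have h1 : ⟪N x₁, N x₁⟫_ℂ = 1 := by
      have h2 : star N (N x₁) = x₁ := by
        have h3 : star N (N x₁) = P x₁ :=
          congrArg (fun A : H →L[ℂ] H => A x₁) (star_outerPart_mul_outerPart hT hc hr)
        rw [h3, hPx]
      rw [← ContinuousLinearMap.adjoint_inner_right, ← ContinuousLinearMap.star_eq_adjoint, h2, hxx]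
    have h2 : ‖N x₁‖ ^ 2 = 1 := by rw [norm_sq_eq_re_inner (𝕜 := ℂ), h1]; simp
    nlinarith [norm_nonneg (N x₁)]
  have hwn : ‖w‖ = 1 := by rw [hw, norm_smul, hu, hNN, one_mul]
  have hxw : ⟪x₁, w⟫_ℂ = (c : ℂ) := by rw [hw, inner_smul_right, ← huc]
  have hPw : P w = w := by
    have h1 : P (N x₁) = N x₁ :=
      congrArg (fun A : H →L[ℂ] H => A x₁) (outerProj_mul_outerPart hT hc hr)
    rw [hw, map_smul, h1]
  obtain ⟨R, hR, hRx, hRfix, hRn⟩ := exists_unitary_rotation hx₁n hwn (norm_nonneg _) hxw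
  refine ⟨R, hR, x₁, hx₁n, fun y hy => hRfix y ?_ ?_, hRn.trans ?_, ?_, hdist, _, ha0.le, h01⟩
  · rw [← hPx, inner_apply_left_of_star_eq hPs, hy, inner_zero_right]
  · rw [← hPw, inner_apply_left_of_star_eq hPs, hy, inner_zero_right]
  · refine Real.le_sqrt_of_sq_le ?_
    have h1 := @norm_sub_sq ℂ H _ _ _ x₁ w
    rw [hxw, hwn, hx₁n, norm_sub_rev] at h1
    have h2 : RCLike.re (c : ℂ) = c := Complex.ofReal_re _
    rw [h2] at h1
    linarith
  · have h1 : innerPart (1 - s) T x₁ = 0 := by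
      rw [← hPx]
      exact congrArg (fun A : H →L[ℂ] H => A x₁) (innerPart_mul_outerProj hT hc hr)
    have h2 : star R w = x₁ := by
      rw [← hRx]
      exact congrArg (fun A : H →L[ℂ] H => A x₁) (Unitary.star_mul_self_of_mem hR)
    have h3 : N x₁ = u⁻¹ • w := by rw [hw, smul_smul, inv_mul_cancel₀ hu0, one_smul]
    have h4 : rotatedSum (1 - s) T R x₁ = u⁻¹ • x₁ := by
      change star R (N x₁) + innerPart (1 - s) T x₁ = _
      rw [h1, add_zero, h3, map_smul, h2]
    rw [h4, inner_smul_right, hxx, mul_one, norm_inv, hu, inv_one]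

/-- With `d` the rank of `P`, `σ_p(A) ≤ d^(1/p) ‖A‖`; as `T` is bounded below by `r` on the range of
`P`, `d^(1/p) r ≤ σ_p(T) ≤ M`. -/
theorem schattenNorm_le_of_mul_outerProj {p : ℝ} (hp : 1 ≤ p) {T A : H →L[ℂ] H}
    (hT : IsStarNormal T) (hc : IsCompactOperator T) {r M : ℝ} (hr : 0 < r)
    (hM : schattenNorm p T ≤ ENNReal.ofReal M) (hA : A * outerProj r T = A) {B : ℝ}
    (hAB : ‖A‖ ≤ B) : schattenNorm p A ≤ ENNReal.ofReal (B * (M / r)) := by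
  have hp0 : 0 < p := by linarith
  have hB : 0 ≤ B := (norm_nonneg A).trans hAB
  have hfd := ContinuousLinearMap.finite_dimensional_eigenspace
    (isCompactOperator_outerProj hT hc hr) 1 one_ne_zero
  set W := Module.End.eigenspace (outerProj r T).toLinearMap (1 : ℂ) with hW
  have hmem : ∀ y, y ∈ W ↔ outerProj r T y = y := fun y => by
    rw [hW, Module.End.mem_eigenspace_iff, one_smul]; rfl
  have hcomm : outerProj r T * (star T * T) = star T * T * outerProj r T := by
    have h1 := (outerProj_mul hT hc hr).trans (mul_outerProj hT hc hr).symm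
    have h2 := congrArg star h1
    rw [star_mul, star_mul, star_outerProj] at h2
    rw [← mul_assoc, ← h2, mul_assoc, h1, mul_assoc]
  have hlow : (Module.finrank ℂ W : ℝ≥0∞) * ENNReal.ofReal (r ^ p) ≤ schattenSum p T := by
    refine finrank_mul_le_schattenSum hp hc hr W (fun y hy => ?_)
      (fun y hy => le_norm_apply_of_outerProj hT hc hr ((hmem y).1 hy))
    rw [hmem] at hy ⊢
    have h1 : outerProj r T ((star T * T) y) = (star T * T) (outerProj r T y) :=
      congrArg (fun C : H →L[ℂ] H => C y) hcomm
    rw [hy] at h1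
    exact h1
  have hup := schattenSum_le_of_mul_eq hp star_outerProj hA
  have hroot : ∀ d t : ℝ≥0∞, (d * t ^ p) ^ (1 / p) = d ^ (1 / p) * t := fun d t => by
    rw [ENNReal.mul_rpow_of_nonneg _ _ (by positivity), ← ENNReal.rpow_mul,
      mul_one_div_cancel hp0.ne', ENNReal.rpow_one]
  have hlow' : (Module.finrank ℂ W : ℝ≥0∞) ^ (1 / p) * ENNReal.ofReal r ≤ ENNReal.ofReal M := by
    rw [← hroot, ENNReal.ofReal_rpow_of_nonneg hr.le hp0.le]
    refine le_trans ?_ hM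
    rw [schattenNorm_eq]
    exact ENNReal.rpow_le_rpow hlow (by positivity)
  have hr0 : ENNReal.ofReal r ≠ 0 := (ENNReal.ofReal_pos.2 hr).ne'
  calc schattenNorm p A
      ≤ (Module.finrank ℂ W * ENNReal.ofReal (‖A‖ ^ p)) ^ (1 / p) := by
        rw [schattenNorm_eq]
        exact ENNReal.rpow_le_rpow hup (by positivity)
    _ = (Module.finrank ℂ W : ℝ≥0∞) ^ (1 / p) * ENNReal.ofReal ‖A‖ := by
        rw [← ENNReal.ofReal_rpow_of_nonneg (norm_nonneg A) hp0.le, hroot]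
    _ ≤ ENNReal.ofReal M / ENNReal.ofReal r * ENNReal.ofReal B := by
        gcongr
        rwa [ENNReal.le_div_iff_mul_le (Or.inl hr0) (Or.inl ENNReal.ofReal_ne_top)]
    _ = ENNReal.ofReal (B * (M / r)) := by
        rw [← ENNReal.ofReal_div_of_pos hr, mul_comm, ENNReal.ofReal_mul hB]

end

/-! ### Membership in the Schatten classes and return to the point `x₀`. -/

section

variable {H : Type*} [NormedAddCommGroup H] [InnerProductSpace ℂ H] [CompleteSpace H]

theorem rotatedSum_mem_normalSchattenClass {p : ℝ} (hp : 1 ≤ p) {T R : H →L[ℂ] H}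
    (hT : T ∈ normalSchattenClass H p) {r : ℝ} (hr : 0 < r) (hR : R ∈ unitary (H →L[ℂ] H))
    (hfix : ∀ y, outerProj r T y = 0 → R y = y) :
    rotatedSum r T R ∈ normalSchattenClass H p := by
  obtain ⟨hn, hc, hs⟩ := hT
  refine ⟨isStarNormal_rotatedSum hn hc hr hR hfix, isCompactOperator_rotatedSum hn hc hr, ?_⟩
  rw [schattenNorm_lt_top_iff hp] at hs ⊢
  exact schattenSum_lt_top_of_absEigenspace_le hc hs
    fun l hl hl1 => absEigenspace_rotatedSum_le hn hc hr hR hfix hl hl1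

theorem unitary_conj_mem_normalSchattenClass {p : ℝ} {S U : H →L[ℂ] H}
    (hS : S ∈ normalSchattenClass H p) (hU : U ∈ unitary (H →L[ℂ] H)) :
    star U * S * U ∈ normalSchattenClass H p := by
  obtain ⟨hn, hc, hs⟩ := hS
  have hUU : ∀ A, U * (star U * A) = A := fun A => by
    rw [← mul_assoc, Unitary.mul_star_self_of_mem hU, one_mul]
  refine ⟨⟨?_⟩, ?_, ?_⟩
  · have h := hn.star_comm_self.eq
    rw [Commute, SemiconjBy]
    simp only [star_mul, star_star, mul_assoc, hUU]
    rw [← mul_assoc (star S), h, mul_assoc]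
  · exact IsCompactOperator.comp_clm (hc.clm_comp (star U)) U
  · rwa [schattenNorm_eq, schattenSum_unitary_conj p hU, ← schattenNorm_eq]

theorem norm_unitary_conj_sub_le {S U : H →L[ℂ] H} (hU : U ∈ unitary (H →L[ℂ] H))
    (hS : ‖S‖ ≤ 1) : ‖star U * S * U - S‖ ≤ 2 * ‖U - 1‖ := by
  have hUs : star U ∈ unitary (H →L[ℂ] H) := Unitary.star_mem hU
  have h : star U * S * U - S = star U * (S * (U - 1)) + star (U - 1) * S := by
    rw [star_sub, star_one]; noncomm_ring
  calc ‖star U * S * U - S‖ ≤ ‖star U * (S * (U - 1))‖ + ‖star (U - 1) * S‖ := by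
        rw [h]; exact norm_add_le _ _
    _ ≤ ‖U - 1‖ + ‖U - 1‖ := by
        rw [CStarRing.norm_mem_unitary_mul _ hUs]
        gcongr
        · refine (norm_mul_le _ _).trans ?_
          exact mul_le_of_le_one_left (norm_nonneg _) hS
        · refine (norm_mul_le _ _).trans ?_
          rw [norm_star]
          exact mul_le_of_le_one_right (norm_nonneg _) hS
    _ = 2 * ‖U - 1‖ := by ring

theorem sqrt_two_mul_add_sq_le {s : ℝ} (hs : 0 ≤ s) : √(2 * s + s ^ 2) ≤ s + 2 * √s := by
  refine Real.sqrt_le_iff.2 ⟨by positivity, ?_⟩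
  have h := Real.sq_sqrt hs
  nlinarith [mul_nonneg hs (Real.sqrt_nonneg s)]

/-- The approximation with the point `x₀` kept fixed; `η` depends on `ε` only. -/
theorem exists_approx_at_point {ε : ℝ} (hε : 0 < ε) : ∃ η : ℝ, 0 < η ∧
    ∀ p : ℝ, 1 ≤ p → ∀ T ∈ normalSchattenClass H p, numericalRadius T = 1 →
      ∀ x₀ : H, ‖x₀‖ = 1 → ‖⟪x₀, T x₀⟫_ℂ‖ > 1 - η →
      ∃ S ∈ normalSchattenClass H p, numericalRadius S = 1 ∧ ‖⟪x₀, S x₀⟫_ℂ‖ = 1 ∧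
        ‖S - T‖ < ε := by
  -- With `s = t²` the conjugation costs at most `2t` and the approximation at most `2t² + 2t`, in
  -- total at most `5t`.
  obtain ⟨t, ht0, ht2, htε⟩ : ∃ t : ℝ, 0 < t ∧ t ≤ 1 / 2 ∧ 7 * t ≤ ε :=
    ⟨min (1 / 2) (ε / 7), by positivity, min_le_left _ _, by
      have := min_le_right (1 / 2) (ε / 7); linarith⟩
  refine ⟨(t ^ 2) ^ 2 / 2, by positivity, fun p hp T hT hν x₀ hx₀ hatt => ?_⟩
  have hs0 : 0 < t ^ 2 := by positivity
  have hs1 : t ^ 2 < 1 := by nlinarith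
  have hr : 0 < 1 - t ^ 2 := by linarith
  have hT1 : ‖T‖ ≤ 1 := hν ▸ norm_le_numericalRadius hT.1 hT.2.1 (hν ▸ one_pos)
  obtain ⟨R, hR, x₁, hx₁, hfix, hRn, hx₁S, hdist, c, hc0, hc⟩ :=
    exists_rotation_attaining hT.1 hT.2.1 hT1 hs0 hs1 hx₀ hatt
  obtain ⟨U, hU, hUx, -, hUn⟩ := exists_unitary_rotation hx₀ hx₁ hc0 hc
  have hS := rotatedSum_mem_normalSchattenClass hp hT hr hR hfix
  have hS1 := norm_rotatedSum_le hT.1 hT.2.1 hr (by linarith) hR hfix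
  have hST := norm_rotatedSum_sub_le (R := R) hT.1 hT.2.1 hr (by linarith) hT1
  set S := rotatedSum (1 - t ^ 2) T R with hSdef
  have hval : ‖⟪x₀, (star U * S * U) x₀⟫_ℂ‖ = 1 := by
    rw [← hx₁S, ← hUx, ContinuousLinearMap.star_eq_adjoint]
    congr 1
    exact ContinuousLinearMap.adjoint_inner_right U x₀ (S (U x₀))
  have hnorm : ‖star U * S * U‖ ≤ 1 := by
    rwa [CStarRing.norm_mul_mem_unitary _ hU,
      CStarRing.norm_mem_unitary_mul _ (Unitary.star_mem hU)]
  refine ⟨star U * S * U, unitary_conj_mem_normalSchattenClass hS hU,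
    numericalRadius_eq_one hnorm hx₀ hval, hval, ?_⟩
  have h1 := norm_unitary_conj_sub_le hU hS1
  have h2 := norm_sub_le_norm_sub_add_norm_sub (star U * S * U) S T
  have h3 := sqrt_two_mul_add_sq_le hs0.le
  rw [Real.sqrt_sq ht0.le] at h3 hdist
  nlinarith

end

end BPBNu

end

/-! ### Assembly of the three assertions. -/

theorem proposition4p3 {H : Type*} [NormedAddCommGroup H] [InnerProductSpace ℂ H]
    [CompleteSpace H] :
    -- the point property for the normal operators in `S_p(H)`, for each `p`
    (∀ p : ℝ, 1 ≤ p → BPBNu.HasBPBppNu (BPBNu.normalSchattenClass H p)) ∧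
    -- the point property for the class of all normal Schatten-von Neumann operators
    BPBNu.HasBPBppNu {T : H →L[ℂ] H | ∃ p : ℝ, 1 ≤ p ∧ T ∈ BPBNu.normalSchattenClass H p} ∧
    -- the explicit approximation in the Schatten `p`-norm
    (∀ p : ℝ, 1 ≤ p → ∀ ε : ℝ, 0 < ε → ε < 1 / 2 →
      ∀ T ∈ BPBNu.normalSchattenClass H p, BPBNu.numericalRadius T = 1 →
      ∀ M : ℝ, BPBNu.schattenNorm p T ≤ ENNReal.ofReal M →
      ∀ x₀ : H, ‖x₀‖ = 1 → ‖inner ℂ x₀ (T x₀)‖ > 1 - ε →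
      ∃ R ∈ unitary (H →L[ℂ] H), ∃ S ∈ BPBNu.normalSchattenClass H p, ∃ x₁ : H,
        (∀ y : H, BPBNu.outerProj (1 - √(2 * ε)) T y = 0 → R y = y) ∧
        S = star R * BPBNu.outerPart (1 - √(2 * ε)) T + BPBNu.innerPart (1 - √(2 * ε)) T ∧
        ‖x₁‖ = 1 ∧ BPBNu.numericalRadius S = 1 ∧ ‖inner ℂ x₁ (S x₁)‖ = 1 ∧
        ‖x₁ - x₀‖ ≤ √(2 * ε) + (2 * ε) ^ (1 / 4 : ℝ) ∧
        ‖S - T‖ ≤ 1 / (1 - √(2 * ε)) * (√(2 * ε) + 2 * (2 * ε) ^ (1 / 4 : ℝ))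
          + 2 * √(2 * ε) ∧
        BPBNu.schattenNorm p (S - T) ≤ ENNReal.ofReal
          ((1 / (1 - √(2 * ε)) * (√(2 * ε) + 2 * (2 * ε) ^ (1 / 4 : ℝ)) + √(2 * ε))
              * (M / (1 - √(2 * ε)))
            + M * √(2 * ε) / (1 - √(2 * ε)))) := by
  refine ⟨fun p hp ε hε => ?_, fun ε hε => ?_, ?_⟩
  · obtain ⟨η, hη, h⟩ := BPBNu.exists_approx_at_point (H := H) hε
    exact ⟨η, hη, h p hp⟩
  · obtain ⟨η, hη, h⟩ := BPBNu.exists_approx_at_point (H := H) hε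
    refine ⟨η, hη, ?_⟩
    rintro T ⟨p, hp, hT⟩ hν x₀ hx₀ hatt
    obtain ⟨S, hS, hS'⟩ := h p hp T hT hν x₀ hx₀ hatt
    exact ⟨S, ⟨p, hp, hS⟩, hS'⟩
  · intro p hp ε hε hε2 T hT hν M hM x₀ hx₀ hatt
    have hroot : (2 * ε) ^ (1 / 4 : ℝ) = √√(2 * ε) := by
      rw [Real.sqrt_eq_rpow, Real.sqrt_eq_rpow, ← Real.rpow_mul (by positivity)]
      norm_num
    rw [hroot]
    have hsq : √(2 * ε) ^ 2 = 2 * ε := Real.sq_sqrt (by positivity)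
    have hs0 : 0 < √(2 * ε) := Real.sqrt_pos.2 (by positivity)
    set s := √(2 * ε) with hs
    have hs1 : s < 1 := by nlinarith
    have hr : 0 < 1 - s := by linarith
    have hT1 : ‖T‖ ≤ 1 := hν ▸ BPBNu.norm_le_numericalRadius hT.1 hT.2.1 (hν ▸ one_pos)
    obtain ⟨R, hR, x₁, hx₁, hfix, hRn, hx₁S, hdist, -⟩ :=
      BPBNu.exists_rotation_attaining hT.1 hT.2.1 hT1 hs0 hs1 hx₀
        (by rw [hsq]; linarith)
    -- The bound obtained for `‖R - 1‖` lacks the factor `1 / (1 - s)`, so the stated estimate is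
    -- weaker.
    have hX : s + 2 * √s ≤ 1 / (1 - s) * (s + 2 * √s) :=
      le_mul_of_one_le_left (by positivity) ((one_le_div hr).2 (by linarith))
    set X := 1 / (1 - s) * (s + 2 * √s) with hXdef
    have hST : ‖BPBNu.rotatedSum (1 - s) T R - T‖ ≤ X + s := by
      have h1 := BPBNu.norm_rotatedSum_sub_le (R := R) hT.1 hT.2.1 hr (by linarith) hT1
      have h2 := BPBNu.sqrt_two_mul_add_sq_le hs0.le
      linarith
    refine ⟨R, hR, BPBNu.rotatedSum (1 - s) T R,
      BPBNu.rotatedSum_mem_normalSchattenClass hp hT hr hR hfix, x₁, hfix, rfl, hx₁,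
      BPBNu.numericalRadius_eq_one
        (BPBNu.norm_rotatedSum_le hT.1 hT.2.1 hr (by linarith) hR hfix) hx₁ hx₁S, hx₁S,
      by linarith, by linarith, ?_⟩
    refine (BPBNu.schattenNorm_le_of_mul_outerProj hp hT.1 hT.2.1 hr hM
      (BPBNu.rotatedSum_sub_mul_outerProj hT.1 hT.2.1 hr) hST).trans ?_
    have hX0 : 0 ≤ X + s := (norm_nonneg _).trans hST
    -- For `M ≥ 0` the last summand of the stated bound is pure slack. For `M < 0` it is negative,
    -- but then `ENNReal.ofReal` truncates the bound already obtained to `0`.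
    rcases le_or_gt 0 M with hM0 | hM0
    · refine ENNReal.ofReal_le_ofReal (le_add_of_nonneg_right (by positivity))
    · rw [ENNReal.ofReal_of_nonpos]
      · exact zero_le
      · exact mul_nonpos_of_nonneg_of_nonpos hX0 (div_nonpos_of_nonpos_of_nonneg hM0.le hr.le)
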